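/- Let $T>0$, $f:[0,T]\times\mathbb R^n\times\mathbb R^m\to\mathbb R^n$, $U(t)\subset\mathbb R^m$ $(t\in[0,T])$, $\ell:\mathbb R^n\times\mathbb R^n\to\mathbb R$, $g:[0,T]\times\mathbb R^n\to\mathbb R$, $\Phi:\mathbb R^n\times\mathbb R^n\to\mathbb R^r$, $S\subset\mathbb R^r$, and consider the problem $$\textbf{(OC)}\qquad \text{minimize } \ell(x(0),x(T))\quad\text{s.t. } \dot x=f(t,x,u),\ u\in U(t),\ g(t,x(t))\le 0,\ \Phi(x(0),x(T))\in S ,$$ where $x(\cdot)$ is absolutely continuous on $[0,T]$, $u(\cdot)\in L^\infty$, the relations $\dot x=f(t,x,u)$ and $u\in U(t)$ hold almost everywhere, and $g(t,x(t))\le0$ holds for all $t\in[0,T]$. Let $(\bar x,\bar u)$ be a strong local minimum in (OC): it is feasible, and for some $\varepsilon>0$ one has $\ell(\bar x(0),\bar x(T))\le\ell(x(0),x(T))$ for all feasible $(x,u)$ with $\|x(t)-\bar x(t)\|<\varepsilon$ for all $t$. Let $\varepsilon_0>0$, $\delta_0\ge0$, write $B(a,\rho)$ for the closed ball and put $U_0(t)=B(\bar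 u(t),\delta_0)\cap U(t)$. Assume: (H1) $\ell$ is Lipschitz in a neighborhood of $(\bar x(0),\bar x(T))$; (H2) there is a summable $k_0$ such that for a.e. $t$, for all $v\in U_0(t)$ and $x,x'\in B(\bar x(t),\varepsilon_0)$: $\|f(t,\bar x(t),v)\|\le k_0(t)$ and $\|f(t,x,v)-f(t,x',v)\|\le k_0(t)\|x-x'\|$; moreover, for a.e. $t$, $U_0(t)$ is closed and $f(t,x,\cdot)$ is continuous on $U_0(t)$ for every $x\in B(\bar x(t),\varepsilon_0)$ (which is automatic if $\delta_0=0$); (H3) for every $h\in\mathbb R^n$ with $\|h\|\le\varepsilon_0$ the set-valued mapping $t\mapsto\{(v,f(t,\bar x(t)+h,v)): v\in U(t)\}$ on $[0,T]$ has an $\mathcal L\times\mathcal B$-measurable graph, that is, its graph belongs to the product of the Lebesgue $\sigma$-algebra on $[0,T]$ and the Borel $\sigma$-algebra; (H4) $g$ is upper semicontinuous on $[0,T]\times\mathbb R^n$, and for some $\rho_0>0$ every $g(t,\cdot)$, $t\in[0,T]$, is $\rho_0$-Lipschitz on $B(\bar x(t),\varepsilon_0)$; (H5) $S$ is closed, $\Phi$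 is continuously differentiable near $(\bar x(0),\bar x(T))$, and $\Phi'(\bar x(0),\bar x(T))$ maps onto $\mathbb R^r$. Let $\mathcal U$ be the set of all $u\in L^\infty([0,T];\mathbb R^m)$ with $u(t)\in U(t)$ a.e. for which there are $\gamma>0$ and a summable $k_u$ such that for a.e. $t$ one has $\|f(t,\bar x(t),u(t))\|\le k_u(t)$ and $\|f(t,x,u(t))-f(t,x',u(t))\|\le k_u(t)\|x-x'\|$ for all $x,x'\in B(\bar x(t),\gamma)$. Let $u_1,\dots,u_k\in\mathcal U$, $U_k(t)=U_0(t)\cup\{u_1(t),\dots,u_k(t)\}$, and let $\mathcal U_k$ be the set of measurable $u(\cdot)$ with $u(t)\in U_k(t)$ a.e. Let $X_k$ be the set of pairs $(x,u)$ with $x$ absolutely continuous, $u\in\mathcal U_k$, $\dot x=f(t,x,u)$ a.e. and $\|x-\bar x\|_C\le\varepsilon_0$, with the metric of $C([0,T])\times L^1$. Let $Z_k$ be the set of tuples $z=(x,u,\alpha_1,\dots,\alpha_k)$ with $x\in W^{1,1}([0,T];\mathbb R^n)$, $u\in\mathcal U_k$, $\alpha_i\ge0$, $\sum_i\alpha_i\le1$,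 with the topology of $W^{1,1}\times L^\infty\times\mathbb R^k$. For $j=1,2,\dots$ put $$\psi_j(x)=\max\Big\{\ell(x(0),x(T))-\ell(\bar x(0),\bar x(T))+j^{-2},\ \max_{0\le t\le T}g(t,x(t))\Big\},$$ $$J_k(z)=\int_0^T\Big\|\dot x(t)-f(t,x(t),u(t))-\sum_{i=1}^k\alpha_i\big(f(t,x(t),u_i(t))-f(t,x(t),u(t))\big)\Big\|\,dt .$$ Then there are $\lambda\ge0$, $K>0$ and a sequence $(\bar x_j,\bar u_j)\in X_k$, $j=1,2,\dots$, converging to $(\bar x,\bar u)$ in $X_k$, such that for every $j\geq 1$ the functional $$\lambda\psi_j(x)+d(\Phi(x(0),x(T)),S)+KJ_k(z)+\frac1j\Big(\|x-\bar x_j\|_C+\int_0^T\Big(\|u(t)-\bar u_j(t)\|+\sum_{i=1}^k\alpha_i\|u_i(t)-\bar u_j(t)\|\Big)dt\Big)$$ of $z=(x,u,\alpha_1,\dots,\alpha_k)$ attains a local minimum on $Z_k$ at $(\bar x_j,\bar u_j,0,\dots,0)$. Moreover, either $\lambda>0$, or $\lambda=0$ and $\Phi(\bar x_j(0),\bar x_j(T))\notin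 S$ for every $j\geq 1$. -/

import Mathlib

open Set Filter Topology MeasureTheory

noncomputable section

/-- Euclidean space `ℝⁿ`. -/
abbrev Euc (n : ℕ) : Type := EuclideanSpace ℝ (Fin n)

/-- The data of the optimal control problem
minimize `cost (x 0, x T)` subject to `x' = f (t, x, u)`, `u ∈ U t`, `g (t, x t) ≤ 0` on `[0, T]`
and `Φ (x 0, x T) ∈ S`, with states in `ℝⁿ` and controls in `ℝᵐ`. -/
structure OCProblem (n m r : ℕ) where
  T : ℝ
  T_pos : 0 < T
  cost : Euc n × Euc n → ℝ
  f : ℝ → Euc n → Euc m → Euc n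
  U : ℝ → Set (Euc m)
  g : ℝ → Euc n → ℝ
  Φ : Euc n × Euc n → Euc r
  S : Set (Euc r)

/-- `ℒ × ℬ`-measurability of a subset of `ℝ × Y`: membership in the product of the σ-algebra of
Lebesgue measurable sets with the σ-algebra of `Y`. -/
def IsLBMeasurable {Y : Type*} [MeasurableSpace Y] (A : Set (ℝ × Y)) : Prop :=
  @MeasurableSet (NullMeasurableSpace ℝ (volume : Measure ℝ) × Y) Prod.instMeasurableSpace A

namespace OCProblem

variable {n m r : ℕ} (P : OCProblem n m r)

/-- Lebesgue measure on `[0, T]`. -/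
def leb : Measure ℝ := volume.restrict (Icc 0 P.T)

/-- The pair of end points of a trajectory. -/
def ends (x : ℝ → Euc n) : Euc n × Euc n := (x 0, x P.T)

/-- The norm of `C([0, T])`. -/
def normC (x : ℝ → Euc n) : ℝ := ⨆ t : Icc (0 : ℝ) P.T, ‖x t‖

/-- The norm of `L¹([0, T])`. -/
def normL1 {d : ℕ} (v : ℝ → Euc d) : ℝ := ∫ t in (0 : ℝ)..P.T, ‖v t‖

/-- The space `W^{1,1}` of absolutely continuous mappings on `[0, T]`. -/
def W11 : Set (ℝ → Euc n) := {x | AbsolutelyContinuousOnInterval x 0 P.T}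

/-- The distance of `W^{1,1}`, that is `‖x 0 - y 0‖ + ‖x' - y'‖_{L¹}`. -/
def distW11 (x y : ℝ → Euc n) : ℝ :=
  ‖x 0 - y 0‖ + P.normL1 (fun t => deriv x t - deriv y t)

/-- `x` is absolutely continuous and `x' = f (t, x, u)` almost everywhere on `[0, T]`. -/
def SolvesODE (x : ℝ → Euc n) (u : ℝ → Euc m) : Prop :=
  x ∈ P.W11 ∧ ∀ᵐ t ∂P.leb, deriv x t = P.f t (x t) (u t)

/-- Control processes; controls are measurable and essentially bounded. -/
def IsControlPair (x : ℝ → Euc n) (u : ℝ → Euc m) : Prop :=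
  MemLp u ⊤ P.leb ∧ (∀ᵐ t ∂P.leb, u t ∈ P.U t) ∧ P.SolvesODE x u

/-- Feasible control processes. -/
def IsFeasible (x : ℝ → Euc n) (u : ℝ → Euc m) : Prop :=
  P.IsControlPair x u ∧ (∀ t ∈ Icc (0 : ℝ) P.T, P.g t (x t) ≤ 0) ∧ P.Φ (P.ends x) ∈ P.S

/-- Strong local minimum: a feasible process that is optimal among all feasible processes whose
trajectory is uniformly close, without any restriction on the control. -/
def IsStrongLocalMin (xb : ℝ → Euc n) (ub : ℝ → Euc m) : Prop :=
  P.IsFeasible xb ub ∧ ∃ ε > 0, ∀ x u, P.IsFeasible x u →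
    (∀ t ∈ Icc (0 : ℝ) P.T, ‖x t - xb t‖ < ε) → P.cost (P.ends xb) ≤ P.cost (P.ends x)

/-- The cost is Lipschitz near the end points of `xb`. -/
def H1 (xb : ℝ → Euc n) : Prop :=
  ∃ L, ∃ s ∈ 𝓝 (P.ends xb), LipschitzOnWith L P.cost s

/-- The sets `U₀ t = B (ub t, δ₀) ∩ U t`. -/
def U0 (ub : ℝ → Euc m) (δ₀ : ℝ) (t : ℝ) : Set (Euc m) := Metric.closedBall (ub t) δ₀ ∩ P.U t

/-- Bound and Lipschitz condition for the dynamics near `xb`, uniformly over `U₀`. -/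
def H2 (xb : ℝ → Euc n) (ub : ℝ → Euc m) (ε₀ δ₀ : ℝ) : Prop :=
  ∃ k₀ : ℝ → ℝ, Integrable k₀ P.leb ∧ ∀ᵐ t ∂P.leb, ∀ v ∈ P.U0 ub δ₀ t,
    ‖P.f t (xb t) v‖ ≤ k₀ t ∧
    ∀ x ∈ Metric.closedBall (xb t) ε₀, ∀ x' ∈ Metric.closedBall (xb t) ε₀,
      ‖P.f t x v - P.f t x' v‖ ≤ k₀ t * ‖x - x'‖

/-- The set-valued mappings `t ↦ {(v, f (t, xb t + h, v)) : v ∈ U t}`, `‖h‖ ≤ ε₀`, have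
`ℒ × ℬ`-measurable graphs. -/
def H3 (xb : ℝ → Euc n) (ε₀ : ℝ) : Prop :=
  ∀ h : Euc n, ‖h‖ ≤ ε₀ → IsLBMeasurable
    {p : ℝ × (Euc m × Euc n) |
      p.1 ∈ Icc 0 P.T ∧ p.2.1 ∈ P.U p.1 ∧ p.2.2 = P.f p.1 (xb p.1 + h) p.2.1}

/-- The state constraint is upper semicontinuous and uniformly Lipschitz in `x` near `xb`. -/
def H4 (xb : ℝ → Euc n) (ε₀ : ℝ) : Prop :=
  UpperSemicontinuousOn (fun p : ℝ × Euc n => P.g p.1 p.2) (Icc 0 P.T ×ˢ univ) ∧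
  ∃ ρ₀ > 0, ∀ t ∈ Icc (0 : ℝ) P.T,
    ∀ x ∈ Metric.closedBall (xb t) ε₀, ∀ x' ∈ Metric.closedBall (xb t) ε₀,
      |P.g t x - P.g t x'| ≤ ρ₀ * ‖x - x'‖

/-- `S` is closed, and `Φ` is `C¹` near the end points of `xb` with derivative onto there. -/
def H5 (xb : ℝ → Euc n) : Prop :=
  IsClosed P.S ∧ ContDiffAt ℝ 1 P.Φ (P.ends xb) ∧
    Function.Surjective (fderiv ℝ P.Φ (P.ends xb))

/-- For almost every `t` the set `U₀ t` is closed and the dynamics is continuous in the control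
on it. This is automatic for `δ₀ = 0`, when `U₀ t = {ub t}`. -/
def U0ClosedContinuous (xb : ℝ → Euc n) (ub : ℝ → Euc m) (ε₀ δ₀ : ℝ) : Prop :=
  ∀ᵐ t ∂P.leb, IsClosed (P.U0 ub δ₀ t) ∧
    ∀ x ∈ Metric.closedBall (xb t) ε₀, ContinuousOn (P.f t x) (P.U0 ub δ₀ t)

/-- The class `𝒰`: (essentially bounded) measurable selections `u` of `U` for which `f (t, ·, u t)`
satisfies an integrable bound and Lipschitz condition near `xb`. -/
def goodControls (xb : ℝ → Euc n) : Set (ℝ → Euc m) :=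
  {u | MemLp u ⊤ P.leb ∧ (∀ᵐ t ∂P.leb, u t ∈ P.U t) ∧
    ∃ γ > 0, ∃ k : ℝ → ℝ, Integrable k P.leb ∧ ∀ᵐ t ∂P.leb,
      ‖P.f t (xb t) (u t)‖ ≤ k t ∧
      ∀ x ∈ Metric.closedBall (xb t) γ, ∀ x' ∈ Metric.closedBall (xb t) γ,
        ‖P.f t x (u t) - P.f t x' (u t)‖ ≤ k t * ‖x - x'‖}

section Reduced

variable (xb : ℝ → Euc n) (ub : ℝ → Euc m) (ε₀ δ₀ : ℝ) {k : ℕ} (w : Fin k → ℝ → Euc m)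

/-- `U_k t = U₀ t ∪ {w₁ t, …, w_k t}`. -/
def Uk (t : ℝ) : Set (Euc m) := P.U0 ub δ₀ t ∪ range (fun i => w i t)

/-- The class `𝒰_k` of measurable `u` with `u t ∈ U_k t` almost everywhere. -/
def controlsK : Set (ℝ → Euc m) :=
  {u | AEMeasurable u P.leb ∧ ∀ᵐ t ∂P.leb, u t ∈ P.Uk ub δ₀ w t}

/-- The set `X_k` of pairs `(x, u)` with `‖x - xb‖_C ≤ ε₀`, `u ∈ 𝒰_k` and `x' = f (t, x, u)`. -/
def Xk : Set ((ℝ → Euc n) × (ℝ → Euc m)) :=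
  {z | P.normC (fun t => z.1 t - xb t) ≤ ε₀ ∧ z.2 ∈ P.controlsK ub δ₀ w ∧ P.SolvesODE z.1 z.2}

/-- The set `Z_k` of tuples `(x, u, α₁, …, α_k)` with `x ∈ W^{1,1}`, `u ∈ 𝒰_k`, `α_i ≥ 0` and
`∑ α_i ≤ 1`. -/
def Zk : Set ((ℝ → Euc n) × (ℝ → Euc m) × (Fin k → ℝ)) :=
  {z | z.1 ∈ P.W11 ∧ z.2.1 ∈ P.controlsK ub δ₀ w ∧ (∀ i, 0 ≤ z.2.2 i) ∧ ∑ i, z.2.2 i ≤ 1}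

/-- `F` has at `z₀` a local minimum on `Z_k`, in the topology of `W^{1,1} × L^∞ × ℝᵏ`. -/
def IsLocalMinOnZk (F : (ℝ → Euc n) × (ℝ → Euc m) × (Fin k → ℝ) → ℝ)
    (z₀ : (ℝ → Euc n) × (ℝ → Euc m) × (Fin k → ℝ)) : Prop :=
  z₀ ∈ P.Zk ub δ₀ w ∧ ∃ ρ > 0, ∀ z ∈ P.Zk ub δ₀ w,
    P.distW11 z.1 z₀.1 < ρ →
    eLpNorm (fun t => z.2.1 t - z₀.2.1 t) ⊤ P.leb < ENNReal.ofReal ρ →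
    (∀ i, |z.2.2 i - z₀.2.2 i| < ρ) → F z₀ ≤ F z

/-- The shifted functional
`ψ_j x = max {cost (x 0, x T) - cost (xb 0, xb T) + j⁻², max_t g (t, x t)}`. -/
def psi (j : ℕ) (x : ℝ → Euc n) : ℝ :=
  max (P.cost (P.ends x) - P.cost (P.ends xb) + ((j : ℝ) ^ 2)⁻¹)
    (⨆ t : Icc (0 : ℝ) P.T, P.g t (x t))

/-- The functional
`J_k (x, u, α) = ∫ ‖x' - f (t, x, u) - ∑ α_i (f (t, x, w_i) - f (t, x, u))‖ dt`. -/
def Jk (z : (ℝ → Euc n) × (ℝ → Euc m) × (Fin k → ℝ)) : ℝ :=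
  ∫ t in (0 : ℝ)..P.T,
    ‖deriv z.1 t - P.f t (z.1 t) (z.2.1 t)
      - ∑ i, z.2.2 i • (P.f t (z.1 t) (w i t) - P.f t (z.1 t) (z.2.1 t))‖

/-- The perturbation
`‖x - y‖_C + ∫ (‖u - v‖ + ∑ α_i ‖w_i - v‖) dt` of the functional at a process `(y, v)`. -/
def perturbation (y : ℝ → Euc n) (v : ℝ → Euc m)
    (z : (ℝ → Euc n) × (ℝ → Euc m) × (Fin k → ℝ)) : ℝ :=
  P.normC (fun t => z.1 t - y t) +
    ∫ t in (0 : ℝ)..P.T, (‖z.2.1 t - v t‖ + ∑ i, z.2.2 i * ‖w i t - v t‖)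

/-- The unconstrained functional of index `j`:
`λ ψ_j + d (Φ (x 0, x T), S) + K J_k + j⁻¹ (perturbation)`. -/
def reducedFunctional (lam K : ℝ) (j : ℕ) (y : ℝ → Euc n) (v : ℝ → Euc m)
    (z : (ℝ → Euc n) × (ℝ → Euc m) × (Fin k → ℝ)) : ℝ :=
  lam * P.psi xb j z.1 + Metric.infDist (P.Φ (P.ends z.1)) P.S + K * P.Jk w z
    + (j : ℝ)⁻¹ * P.perturbation w y v z

end Reduced

end OCProblem

end

/-!
The reduced processes, with controls in `U_k` and trajectories in a small tube around `xb`, form a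
complete space `X` for the distance of `C × L¹` (`TubeRegular.processes_complete`), on which the
functionals `φ x = d (Φ (x 0, x T), S)` and `ψ_j` are Lipschitz functions of the trajectory. Since
`(xb, ub)` is a strong minimum, `ψ_j > 0` on the set `M = {φ = 0}` (`psi_pos_of_mem`), while
`ψ_j ≤ j⁻²` at `(xb, ub)`. There are two cases.

* Near `(xb, ub)` the distance to `M` is bounded by a multiple of `φ`. Then `lam * ψ_j + φ` is
  nonnegative there for small `lam > 0`, and Ekeland's principle started at `(xb, ub)` provides
  `(y j, v j)` (`TubeRegular.exists_minimizers_of_regular`).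
* Otherwise Ekeland's principle for `φ` alone, started at processes violating such a bound with
  constant `j`, provides points `(y j, v j)` that do not belong to `M`, and `lam = 0`
  (`TubeRegular.exists_minimizers_of_irregular`).

In both cases `(y j, v j)` minimizes `F x + j⁻¹ * (distance to (y j, v j))` locally over `X`, with
`F` Lipschitz in the uniform norm. It remains to get rid of the differential equation
(`TubeRegular.isLocalMinOnZk`). Given `z = (x, u, α)`, one switches rapidly between `u` and the
controls `w i`, the latter with densities `α i`; this makes `x` a solution up to an error
`J_k z + ε`, and changes the `L¹` distance to `v j` in the way recorded by the perturbation term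
(`exists_chattering`). Filippov's lemma (`TubeRegular.exists_trajectory_near`) yields a process at
uniform distance at most `(J_k z + ε) * exp (∫ κ)` from `x`, so that the minimality over `X` gives
the claim with the penalty constant `(L + 1) * exp (∫ κ)`, where `L` is a Lipschitz constant of `F`
and `1` accounts for the coefficient `j⁻¹ ≤ 1` of the distance; it does not depend on `j`.

The measurability of `t ↦ f (t, x t, u t)` comes from the measurability of the graphs in `H3`
through the Lusin–Souslin theorem, the graph of a superposition being projected injectively.
-/

noncomputable section

/-! ### Absolutely continuous curves -/

theorem AbsolutelyContinuousOnInterval.of_dist_le {X Y : Type*} [PseudoMetricSpace X]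
    [PseudoMetricSpace Y] {f : ℝ → X} {g : ℝ → Y} {a b : ℝ}
    (hg : AbsolutelyContinuousOnInterval g a b)
    (h : ∀ s ∈ uIcc a b, ∀ t ∈ uIcc a b, dist (f s) (f t) ≤ dist (g s) (g t)) :
    AbsolutelyContinuousOnInterval f a b := by
  rw [absolutelyContinuousOnInterval_iff] at hg ⊢
  intro ε hε
  obtain ⟨δ, hδ, H⟩ := hg ε hε
  refine ⟨δ, hδ, fun E hE hlen => lt_of_le_of_lt (Finset.sum_le_sum fun i hi => ?_) (H E hE hlen)⟩
  exact h _ (hE.1 i hi).1 _ (hE.1 i hi).2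

theorem AbsolutelyContinuousOnInterval.integral_of_normed {E : Type*} [NormedAddCommGroup E]
    [NormedSpace ℝ E] {f : ℝ → E} {a b : ℝ} (hf : IntervalIntegrable f volume a b) (c : E) :
    AbsolutelyContinuousOnInterval (fun t => c + ∫ s in a..t, f s) a b := by
  refine (hf.norm.absolutelyContinuousOnInterval_intervalIntegral left_mem_uIcc).of_dist_le ?_
  intro s hs t ht
  have hI : ∀ r ∈ uIcc a b, IntervalIntegrable f volume a r := fun r hr =>
    hf.mono_set (uIcc_subset_uIcc_left hr)
  rw [dist_add_left, dist_eq_norm, dist_eq_norm,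
    intervalIntegral.integral_interval_sub_left (hI s hs) (hI t ht),
    intervalIntegral.integral_interval_sub_left (hI s hs).norm (hI t ht).norm]
  exact intervalIntegral.norm_integral_le_abs_integral_norm

namespace AbsolutelyContinuousOnInterval

variable {n : ℕ} {x : ℝ → Euc n} {a b : ℝ}

theorem coord (hx : AbsolutelyContinuousOnInterval x a b) (i : Fin n) :
    AbsolutelyContinuousOnInterval (fun t => x t i) a b :=
  hx.of_dist_le fun s _ t _ => by
    rw [dist_eq_norm, dist_eq_norm]
    exact PiLp.norm_apply_le (x s - x t) i

theorem ae_differentiableAt_euc (hx : AbsolutelyContinuousOnInterval x a b) :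
    ∀ᵐ t, t ∈ uIcc a b → DifferentiableAt ℝ x t := by
  have : ∀ᵐ t, ∀ i, t ∈ uIcc a b → DifferentiableAt ℝ (fun t => x t i) t :=
    ae_all_iff.2 fun i => (hx.coord i).ae_differentiableAt
  filter_upwards [this] with t ht hmem
  exact (differentiableAt_euclidean).2 fun i => ht i hmem

theorem deriv_coord {t : ℝ} (h : DifferentiableAt ℝ x t) (i : Fin n) :
    deriv (fun t => x t i) t = deriv x t i :=
  ((EuclideanSpace.proj (𝕜 := ℝ) i).hasFDerivAt.comp_hasDerivAt t h.hasDerivAt).deriv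

theorem intervalIntegrable_deriv_euc (hx : AbsolutelyContinuousOnInterval x a b) :
    IntervalIntegrable (deriv x) volume a b := by
  rw [intervalIntegrable_iff]
  refine Integrable.of_eval_piLp fun i => ?_
  have := intervalIntegrable_iff.1 (hx.coord i).intervalIntegrable_deriv
  refine Integrable.congr this ?_
  refine (ae_restrict_iff' measurableSet_uIoc).2 ?_
  filter_upwards [hx.ae_differentiableAt_euc] with t ht hmem
  exact deriv_coord (ht (uIoc_subset_uIcc hmem)) i

theorem eq_add_integral_deriv (hx : AbsolutelyContinuousOnInterval x a b) {t : ℝ}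
    (ht : t ∈ uIcc a b) : x t = x a + ∫ s in a..t, deriv x s := by
  have hxt : AbsolutelyContinuousOnInterval x a t := hx.mono (uIcc_subset_uIcc_left ht)
  have hii := hxt.intervalIntegrable_deriv_euc
  rw [← sub_eq_iff_eq_add']
  ext i
  have h1 := (hxt.coord i).integral_deriv_eq_sub
  have h2 : (∫ s in a..t, deriv x s) i = ∫ s in a..t, deriv x s i :=
    ((EuclideanSpace.proj (𝕜 := ℝ) i).intervalIntegral_comp_comm hii).symm
  rw [h2, PiLp.sub_apply, ← h1]
  refine intervalIntegral.integral_congr_ae ?_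
  filter_upwards [hxt.ae_differentiableAt_euc] with s hs hmem
  exact deriv_coord (hs (uIoc_subset_uIcc hmem)) i

end AbsolutelyContinuousOnInterval

namespace OCProblem

variable {n m r : ℕ} (P : OCProblem n m r)

theorem integrable_leb_iff {E : Type*} [NormedAddCommGroup E] {f : ℝ → E} :
    Integrable f P.leb ↔ IntervalIntegrable f volume 0 P.T :=
  (intervalIntegrable_iff_integrableOn_Icc_of_le P.T_pos.le).symm

theorem intervalIntegral_eq_leb {E : Type*} [NormedAddCommGroup E] [NormedSpace ℝ E] (f : ℝ → E) :
    ∫ t in (0 : ℝ)..P.T, f t = ∫ t, f t ∂P.leb := by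
  rw [intervalIntegral.integral_of_le P.T_pos.le, ← integral_Icc_eq_integral_Ioc]; rfl

theorem ae_leb_iff {p : ℝ → Prop} : (∀ᵐ t ∂P.leb, p t) ↔ ∀ᵐ t, t ∈ Icc 0 P.T → p t :=
  ae_restrict_iff' measurableSet_Icc

instance : IsFiniteMeasure P.leb := by
  unfold leb; infer_instance

theorem uIcc_T : uIcc 0 P.T = Icc 0 P.T := uIcc_of_le P.T_pos.le

variable {P}

theorem W11.continuousOn {x : ℝ → Euc n} (hx : x ∈ P.W11) : ContinuousOn x (Icc 0 P.T) := by
  rw [← P.uIcc_T]; exact AbsolutelyContinuousOnInterval.continuousOn hx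

theorem W11.integrable_deriv {x : ℝ → Euc n} (hx : x ∈ P.W11) : Integrable (deriv x) P.leb :=
  P.integrable_leb_iff.2 (AbsolutelyContinuousOnInterval.intervalIntegrable_deriv_euc hx)

theorem W11.eq_integral {x : ℝ → Euc n} (hx : x ∈ P.W11) {t : ℝ} (ht : t ∈ Icc 0 P.T) :
    x t = x 0 + ∫ s in (0 : ℝ)..t, deriv x s :=
  AbsolutelyContinuousOnInterval.eq_add_integral_deriv hx (by rwa [P.uIcc_T])

theorem intervalIntegrable_of_leb {E : Type*} [NormedAddCommGroup E] {f : ℝ → E}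
    (hf : Integrable f P.leb) {t : ℝ} (ht : t ∈ Icc 0 P.T) : IntervalIntegrable f volume 0 t :=
  (P.integrable_leb_iff.1 hf).mono_set (uIcc_subset_uIcc_left (by rwa [P.uIcc_T]))

theorem integral_congr_leb {E : Type*} [NormedAddCommGroup E] [NormedSpace ℝ E] {f g : ℝ → E}
    (h : ∀ᵐ s ∂P.leb, f s = g s) {t : ℝ} (ht : t ∈ Icc 0 P.T) :
    ∫ s in (0 : ℝ)..t, f s = ∫ s in (0 : ℝ)..t, g s := by
  refine intervalIntegral.integral_congr_ae ?_
  filter_upwards [P.ae_leb_iff.1 h] with s hs hmem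
  rw [uIoc_of_le ht.1] at hmem
  exact hs ⟨hmem.1.le, hmem.2.trans ht.2⟩

/-- A solution of the integral equation is absolutely continuous and solves the differential
equation almost everywhere. -/
theorem solves_of_integral {x φ : ℝ → Euc n} (hφ : Integrable φ P.leb)
    (hx : ∀ t ∈ Icc 0 P.T, x t = x 0 + ∫ s in (0 : ℝ)..t, φ s) :
    x ∈ P.W11 ∧ ∀ᵐ t ∂P.leb, deriv x t = φ t := by
  have hi := P.integrable_leb_iff.1 hφ
  constructor
  · refine (AbsolutelyContinuousOnInterval.integral_of_normed hi (x 0)).of_dist_le ?_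
    intro s hs t ht
    rw [P.uIcc_T] at hs ht
    rw [← hx s hs, ← hx t ht]
  · rw [P.ae_leb_iff]
    have hne : ∀ c : ℝ, ∀ᵐ t : ℝ, t ≠ c := fun c => by simp [ae_iff]
    filter_upwards [hi.ae_hasDerivAt_integral, hne 0, hne P.T] with t ht h0 hT hmem
    have h1 := (ht (by rwa [P.uIcc_T]) 0 (by simp)).const_add (x 0)
    have hI : t ∈ Ioo 0 P.T := ⟨lt_of_le_of_ne hmem.1 h0.symm, lt_of_le_of_ne hmem.2 hT⟩
    refine (h1.congr_of_eventuallyEq ?_).deriv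
    filter_upwards [Ioo_mem_nhds hI.1 hI.2] with s hs
    exact hx s ⟨hs.1.le, hs.2.le⟩

theorem SolvesODE.integral_eq {x : ℝ → Euc n} {u : ℝ → Euc m} (h : P.SolvesODE x u) {t : ℝ}
    (ht : t ∈ Icc 0 P.T) : x t = x 0 + ∫ s in (0 : ℝ)..t, P.f s (x s) (u s) := by
  rw [W11.eq_integral h.1 ht, integral_congr_leb h.2 ht]

theorem norm_integral_le_leb {E : Type*} [NormedAddCommGroup E] [NormedSpace ℝ E] {f : ℝ → E}
    (hf : Integrable f P.leb) {t : ℝ} (ht : t ∈ Icc 0 P.T) :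
    ‖∫ s in (0 : ℝ)..t, f s‖ ≤ ∫ s, ‖f s‖ ∂P.leb := by
  refine (intervalIntegral.norm_integral_le_integral_norm ht.1).trans ?_
  rw [intervalIntegral.integral_of_le ht.1]
  exact setIntegral_mono_set hf.norm (ae_of_all _ fun _ => norm_nonneg _)
    (ae_of_all _ fun s hs => ⟨hs.1.le, hs.2.trans ht.2⟩)

end OCProblem

/-! ### Measurability of the dynamics along curves -/

/-- A set in the product of the Lebesgue `σ`-algebra and the `σ`-algebra of `Y` agrees, off a null
set of times, with a set of the product of the Borel `σ`-algebra and that of `Y`. -/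
theorem IsLBMeasurable.exists_borel {Y : Type*} [MeasurableSpace Y] {A : Set (ℝ × Y)}
    (hA : IsLBMeasurable A) :
    ∃ B : Set (ℝ × Y), MeasurableSet B ∧ ∀ᵐ t : ℝ, ∀ y, (t, y) ∈ A ↔ (t, y) ∈ B := by
  let N := NullMeasurableSpace ℝ (volume : Measure ℝ)
  have hA' : @MeasurableSet (N × Y) (MeasurableSpace.generateFrom
      (image2 (· ×ˢ ·) {s : Set N | MeasurableSet s} {t : Set Y | MeasurableSet t})) A := by
    rw [generateFrom_prod]; exact hA
  refine MeasurableSpace.generateFrom_induction (α := N × Y) _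
    (fun A _ => ∃ B : Set (ℝ × Y), MeasurableSet B ∧
      ∀ᵐ t : ℝ, ∀ y : Y, ((t, y) : N × Y) ∈ A ↔ (t, y) ∈ B) ?_ ?_ ?_ ?_ A hA'
  · rintro _ ⟨a, ha, b, hb, rfl⟩ _
    have ha' : @NullMeasurableSet ℝ _ a volume := ha
    obtain ⟨a', -, ha'm, hae⟩ := NullMeasurableSet.exists_measurable_superset_ae_eq ha'
    refine ⟨a' ×ˢ b, ha'm.prod hb, ?_⟩
    filter_upwards [hae] with t ht y
    have ht' : t ∈ a' ↔ t ∈ a := iff_of_eq ht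
    rw [mem_prod, mem_prod, ht']
    rfl
  · exact ⟨∅, MeasurableSet.empty, by simp⟩
  · rintro s _ ⟨B, hB, h⟩
    refine ⟨Bᶜ, hB.compl, ?_⟩
    filter_upwards [h] with t ht y
    exact not_congr (ht y)
  · intro s _ ih
    choose B hB h using ih
    refine ⟨⋃ i, B i, MeasurableSet.iUnion hB, ?_⟩
    filter_upwards [ae_all_iff.2 h] with t ht y
    simp only [mem_iUnion]
    exact exists_congr fun i => ht i y

/-- Superposition of a mapping with measurable graph and a measurable selection: the graph of the
superposition is Borel over a conull set of times and projects injectively, so that preimages of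
Borel sets are Borel by the Lusin–Souslin theorem. -/
theorem aemeasurable_of_isLBMeasurable_graph {m n : ℕ} {s : Set ℝ} (hs : MeasurableSet s)
    {U : ℝ → Set (Euc m)} {φ : ℝ → Euc m → Euc n} {u : ℝ → Euc m}
    (hG : IsLBMeasurable {p : ℝ × (Euc m × Euc n) |
      p.1 ∈ s ∧ p.2.1 ∈ U p.1 ∧ p.2.2 = φ p.1 p.2.1})
    (hu : AEMeasurable u (volume.restrict s)) (huU : ∀ᵐ t ∂volume.restrict s, u t ∈ U t) :
    AEMeasurable (fun t => φ t (u t)) (volume.restrict s) := by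
  obtain ⟨B, hB, hAB⟩ := hG.exists_borel
  have hgood : ∀ᵐ t ∂volume.restrict s, t ∈ s ∧ u t ∈ U t ∧ u t = hu.mk u t ∧
      ∀ y, (t, y) ∈ {p : ℝ × (Euc m × Euc n) |
        p.1 ∈ s ∧ p.2.1 ∈ U p.1 ∧ p.2.2 = φ p.1 p.2.1} ↔ (t, y) ∈ B := by
    filter_upwards [ae_restrict_mem hs, huU, hu.ae_eq_mk, ae_restrict_of_ae hAB] with t h1 h2 h3 h4
    exact ⟨h1, h2, h3, h4⟩
  obtain ⟨D, hD, hDm, hDsub⟩ := exists_measurable_superset_of_null hgood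
  have hDgood : ∀ t ∉ D, t ∈ s ∧ u t ∈ U t ∧ u t = hu.mk u t ∧
      ∀ y, (t, y) ∈ {p : ℝ × (Euc m × Euc n) |
        p.1 ∈ s ∧ p.2.1 ∈ U p.1 ∧ p.2.2 = φ p.1 p.2.1} ↔ (t, y) ∈ B := fun t ht => by
    by_contra hcon
    exact ht (hD hcon)
  have hgr : ∀ t ∉ D, ∀ y, (t, (hu.mk u t, y)) ∈ B ↔ y = φ t (u t) := by
    intro t ht y
    obtain ⟨h1, h2, h3, h4⟩ := hDgood t ht
    rw [← h4, ← h3]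
    simp [h1, h2]
  refine ⟨Dᶜ.indicator fun t => φ t (u t), ?_, ?_⟩
  · have hpre : ∀ C : Set (Euc n), MeasurableSet C →
        MeasurableSet {t | t ∉ D ∧ φ t (u t) ∈ C} := by
      intro C hC
      have hE : MeasurableSet {q : ℝ × Euc n | q.1 ∉ D ∧ q.2 ∈ C ∧ (q.1, (hu.mk u q.1, q.2)) ∈ B} := by
        refine (measurable_fst hDm.compl).inter ((measurable_snd hC).inter ?_)
        have : Measurable fun q : ℝ × Euc n => (q.1, (hu.mk u q.1, q.2)) :=
          measurable_fst.prodMk ((hu.measurable_mk.comp measurable_fst).prodMk measurable_snd)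
        exact this hB
      have hinj : InjOn Prod.fst
          {q : ℝ × Euc n | q.1 ∉ D ∧ q.2 ∈ C ∧ (q.1, (hu.mk u q.1, q.2)) ∈ B} := by
        rintro ⟨t, y⟩ ⟨h1, -, h2⟩ ⟨t', y'⟩ ⟨-, -, h2'⟩ (h : t = t')
        subst h
        rw [(hgr t h1 y).1 h2, (hgr t h1 y').1 h2']
      convert hE.image_of_measurable_injOn measurable_fst hinj using 1
      ext t
      constructor
      · rintro ⟨h1, h2⟩
        exact ⟨(t, φ t (u t)), ⟨h1, h2, (hgr t h1 _).2 rfl⟩, rfl⟩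
      · rintro ⟨⟨t', y⟩, ⟨h1, h2, h3⟩, rfl⟩
        refine ⟨h1, ?_⟩
        rw [← (hgr t' h1 y).1 h3]
        exact h2
    intro C hC
    have : (Dᶜ.indicator fun t => φ t (u t)) ⁻¹' C =
        {t | t ∉ D ∧ φ t (u t) ∈ C} ∪ (D ∩ {_t | (0 : Euc n) ∈ C}) := by
      ext t
      by_cases ht : t ∈ D <;> simp [ht]
    rw [this]
    exact (hpre C hC).union (hDm.inter (MeasurableSet.const _))
  · have : ∀ᵐ t ∂volume.restrict s, t ∉ D := measure_eq_zero_iff_ae_notMem.1 hDsub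
    filter_upwards [this] with t ht
    simp [ht]

/-- A mapping which is measurable in `t` for fixed `h` is measurable along bounded measurable
curves, provided it is continuous in `h`. -/
theorem aemeasurable_superposition {α : Type*} [MeasurableSpace α] {μ : Measure α} {n : ℕ} {R : ℝ}
    (hR : 0 ≤ R) {F : α → Euc n → Euc n} (hF : ∀ h : Euc n, ‖h‖ ≤ R → AEMeasurable (fun t => F t h) μ)
    (hcont : ∀ᵐ t ∂μ, ContinuousOn (F t) (Metric.closedBall 0 R)) {d : α → Euc n}
    (hd : AEStronglyMeasurable d μ) (hdR : ∀ᵐ t ∂μ, ‖d t‖ ≤ R) :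
    AEMeasurable (fun t => F t (d t)) μ := by
  set d' := hd.mk d with hd'
  have hd'm : StronglyMeasurable d' := hd.stronglyMeasurable_mk
  let s : ℕ → SimpleFunc α (Euc n) := hd'm.approxBounded R
  have hsR : ∀ i t, ‖s i t‖ ≤ R := fun i t => hd'm.norm_approxBounded_le hR i t
  have hsm : ∀ i, AEMeasurable (fun t => F t (s i t)) μ := by
    intro i
    have hsum : (fun t => F t (s i t)) =
        fun t => ∑ h ∈ (s i).range, ((s i) ⁻¹' {h}).indicator (fun t => F t h) t := by
      funext t
      rw [Finset.sum_eq_single (s i t)]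
      · simp
      · intro b _ hb
        exact indicator_of_notMem (by simpa using hb.symm) _
      · intro h
        exact absurd ((s i).mem_range_self t) h
    rw [hsum]
    refine Finset.aemeasurable_fun_sum _ fun h hh => ?_
    refine AEMeasurable.indicator (hF h ?_) ((s i).measurableSet_preimage _)
    obtain ⟨t, rfl⟩ := SimpleFunc.mem_range.1 hh
    exact hsR i t
  refine aemeasurable_of_tendsto_metrizable_ae atTop hsm ?_
  filter_upwards [hcont, hdR, hd.ae_eq_mk] with t hc hR' hmk
  have hlim : Tendsto (fun i => s i t) atTop (𝓝 (d t)) := by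
    rw [hmk]
    exact hd'm.tendsto_approxBounded_of_norm_le (by rw [hd', ← hmk]; exact hR')
  have hmem : d t ∈ Metric.closedBall (0 : Euc n) R := by simpa using hR'
  exact (hc _ hmem).tendsto.comp (tendsto_nhdsWithin_iff.2
    ⟨hlim, Eventually.of_forall fun i => by simpa using hsR i t⟩)

namespace OCProblem

variable {n m r : ℕ} (P : OCProblem n m r)

/-- Measurable selections of a family of control sets. -/
def Selections (V : ℝ → Set (Euc m)) : Set (ℝ → Euc m) :=
  {u | AEMeasurable u P.leb ∧ ∀ᵐ t ∂P.leb, u t ∈ V t}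

/-- Continuous curves in the tube of radius `R` around `xb`. -/
def Tube (xb : ℝ → Euc n) (R : ℝ) : Set (ℝ → Euc n) :=
  {x | ContinuousOn x (Icc 0 P.T) ∧ ∀ t ∈ Icc 0 P.T, ‖x t - xb t‖ ≤ R}

/-- Regularity of the dynamics on the tube of radius `R` around `xb` for controls in `V`: the
properties of the reduced problem with `V = U_k` from which everything else follows. The function
`κ` bounds the velocities along `xb` and the Lipschitz constants in the state, uniformly over
`V t`. -/
structure TubeRegular (xb : ℝ → Euc n) (V : ℝ → Set (Euc m)) (R : ℝ) (κ : ℝ → ℝ) : Prop where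
  continuousOn : ContinuousOn xb (Icc 0 P.T)
  pos : 0 < R
  integrable : Integrable κ P.leb
  nonneg : ∀ t, 0 ≤ κ t
  bound : ∀ᵐ t ∂P.leb, ∀ v ∈ V t, ‖P.f t (xb t) v‖ ≤ κ t ∧
    ∀ x ∈ Metric.closedBall (xb t) R, ∀ x' ∈ Metric.closedBall (xb t) R,
      ‖P.f t x v - P.f t x' v‖ ≤ κ t * ‖x - x'‖
  measurable : ∀ u ∈ P.Selections V, ∀ x ∈ P.Tube xb R,
    AEStronglyMeasurable (fun t => P.f t (x t) (u t)) P.leb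
  closed : ∀ᵐ t ∂P.leb, IsClosed (V t) ∧
    ∀ x ∈ Metric.closedBall (xb t) R, ContinuousOn (P.f t x) (V t)
  subset : ∀ᵐ t ∂P.leb, V t ⊆ P.U t
  bounded : ∃ b : ℝ → ℝ, MemLp b ⊤ P.leb ∧ ∀ᵐ t ∂P.leb, ∀ v ∈ V t, ‖v‖ ≤ b t

variable {P}

theorem TubeRegular.mono {xb : ℝ → Euc n} {V : ℝ → Set (Euc m)} {R R' : ℝ} {κ : ℝ → ℝ}
    (H : P.TubeRegular xb V R κ) (h0 : 0 < R') (h : R' ≤ R) : P.TubeRegular xb V R' κ where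
  continuousOn := H.continuousOn
  pos := h0
  integrable := H.integrable
  nonneg := H.nonneg
  bound := by
    filter_upwards [H.bound] with t ht v hv
    exact ⟨(ht v hv).1, fun x hx x' hx' => (ht v hv).2 x (Metric.closedBall_subset_closedBall h hx)
      x' (Metric.closedBall_subset_closedBall h hx')⟩
  measurable u hu x hx := H.measurable u hu x ⟨hx.1, fun t ht => (hx.2 t ht).trans h⟩
  closed := by
    filter_upwards [H.closed] with t ht
    exact ⟨ht.1, fun x hx => ht.2 x (Metric.closedBall_subset_closedBall h hx)⟩
  subset := H.subset
  bounded := H.bounded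

/-- The closedness of `U_k t` and the continuity of `f (t, x, ·)` on it: finitely many points are
added to the closed set `U₀ t`. -/
theorem closed_continuousOn_Uk {ub : ℝ → Euc m} {δ₀ : ℝ} {k : ℕ} {w : Fin k → ℝ → Euc m}
    {F : Euc m → Euc n} {t : ℝ} (h0 : IsClosed (P.U0 ub δ₀ t)) :
    IsClosed (P.Uk ub δ₀ w t) ∧
      (ContinuousOn F (P.U0 ub δ₀ t) → ContinuousOn F (P.Uk ub δ₀ w t)) := by
  have hfin : (range fun i => w i t).Finite := finite_range _
  refine ⟨h0.union hfin.isClosed, fun hF => hF.union_of_isClosed ?_ h0 hfin.isClosed⟩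
  exact hfin.continuousOn F

/-- The reduced problem is regular on a tube whose radius is the least of `ε₀` and of the radii of
the Lipschitz conditions for the controls `w i`, with `κ` the sum of all the bounds involved. -/
theorem exists_tubeRegular {xb : ℝ → Euc n} {ub : ℝ → Euc m} {ε₀ δ₀ : ℝ} (hε₀ : 0 < ε₀)
    (h2 : P.H2 xb ub ε₀ δ₀) (h3 : P.H3 xb ε₀) (hU : P.U0ClosedContinuous xb ub ε₀ δ₀)
    (hfeas : P.IsFeasible xb ub) {k : ℕ} {w : Fin k → ℝ → Euc m}
    (hw : ∀ i, w i ∈ P.goodControls xb) :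
    ∃ R ≤ ε₀, ∃ κ, P.TubeRegular xb (P.Uk ub δ₀ w) R κ := by
  obtain ⟨k₀, hk₀, hk₀b⟩ := h2
  choose hwL hwU γ hγ kk hkk hkkb using hw
  obtain ⟨R, hR0, hRε, hRγ⟩ : ∃ R > 0, R ≤ ε₀ ∧ ∀ i, R ≤ γ i := by
    rcases isEmpty_or_nonempty (Fin k) with h | h
    · exact ⟨ε₀, hε₀, le_rfl, fun i => isEmptyElim i⟩
    · obtain ⟨i₀, hi₀⟩ := Finite.exists_min γ
      exact ⟨min ε₀ (γ i₀), lt_min hε₀ (hγ i₀), min_le_left _ _,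
        fun i => (min_le_right _ _).trans (hi₀ i)⟩
  have hcont : ContinuousOn xb (Icc 0 P.T) := W11.continuousOn hfeas.1.2.2.1
  set κ : ℝ → ℝ := fun t => |k₀ t| + ∑ i, |kk i t| with hκ
  have hκ0 : ∀ t, |k₀ t| ≤ κ t := fun t =>
    le_add_of_nonneg_right (Finset.sum_nonneg fun _ _ => abs_nonneg _)
  have hκi : ∀ i t, |kk i t| ≤ κ t := fun i t =>
    (Finset.single_le_sum (f := fun i => |kk i t|) (fun _ _ => abs_nonneg _)
      (Finset.mem_univ i)).trans (le_add_of_nonneg_left (abs_nonneg _))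
  have hbound : ∀ᵐ t ∂P.leb, ∀ v ∈ P.Uk ub δ₀ w t, ‖P.f t (xb t) v‖ ≤ κ t ∧
      ∀ x ∈ Metric.closedBall (xb t) R, ∀ x' ∈ Metric.closedBall (xb t) R,
      ‖P.f t x v - P.f t x' v‖ ≤ κ t * ‖x - x'‖ := by
    filter_upwards [hk₀b, ae_all_iff.2 hkkb] with t h0 hi v hv
    rcases hv with hv | ⟨i, rfl⟩
    · refine ⟨(h0 v hv).1.trans ((le_abs_self _).trans (hκ0 t)), fun x hx x' hx' => ?_⟩
      refine ((h0 v hv).2 x (Metric.closedBall_subset_closedBall hRε hx) x'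
        (Metric.closedBall_subset_closedBall hRε hx')).trans ?_
      exact mul_le_mul_of_nonneg_right ((le_abs_self _).trans (hκ0 t)) (norm_nonneg _)
    · refine ⟨(hi i).1.trans ((le_abs_self _).trans (hκi i t)), fun x hx x' hx' => ?_⟩
      refine ((hi i).2 x (Metric.closedBall_subset_closedBall (hRγ i) hx) x'
        (Metric.closedBall_subset_closedBall (hRγ i) hx')).trans ?_
      exact mul_le_mul_of_nonneg_right ((le_abs_self _).trans (hκi i t)) (norm_nonneg _)
  have hsubset : ∀ᵐ t ∂P.leb, P.Uk ub δ₀ w t ⊆ P.U t := by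
    filter_upwards [ae_all_iff.2 hwU] with t hwt v hv
    rcases hv with hv | ⟨i, rfl⟩
    · exact hv.2
    · exact hwt i
  have hsel : ∀ u ∈ P.Selections (P.Uk ub δ₀ w), ∀ᵐ t ∂P.leb, u t ∈ P.U t := by
    intro u hu
    filter_upwards [hu.2, hsubset] with t ht hs using hs ht
  refine ⟨R, hRε, κ, hcont, hR0, ?_, fun t => (abs_nonneg _).trans (hκ0 t), hbound, ?_, ?_,
    hsubset, ?_⟩
  · exact hk₀.abs.add (integrable_finsetSum _ fun i _ => (hkk i).abs)
  · intro u hu x hx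
    have key := aemeasurable_superposition (μ := P.leb) hR0.le
      (F := fun t h => P.f t (xb t + h) (u t)) (d := fun t => x t - xb t)
      (fun h hh => aemeasurable_of_isLBMeasurable_graph measurableSet_Icc
        (φ := fun t v => P.f t (xb t + h) v) (h3 h (hh.trans hRε)) hu.1 (hsel u hu)) ?_ ?_ ?_
    · simpa using key.aestronglyMeasurable
    · filter_upwards [hbound, hu.2] with t hb hut
      have hlip : LipschitzOnWith (κ t).toNNReal (fun h => P.f t (xb t + h) (u t))
          (Metric.closedBall 0 R) := by
        refine LipschitzOnWith.of_dist_le_mul fun h hh h' hh' => ?_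
        have := (hb _ hut).2 (xb t + h) (by simpa using hh) (xb t + h') (by simpa using hh')
        rw [add_sub_add_left_eq_sub] at this
        rw [dist_eq_norm, dist_eq_norm]
        exact this.trans (mul_le_mul_of_nonneg_right (Real.le_coe_toNNReal _) (norm_nonneg _))
      exact hlip.continuousOn
    · exact (hx.1.sub hcont).aestronglyMeasurable measurableSet_Icc
    · exact (ae_restrict_iff' measurableSet_Icc).2 (ae_of_all _ hx.2)
  · filter_upwards [hU] with t ht
    refine ⟨(closed_continuousOn_Uk (F := P.f t 0) ht.1).1, fun x hx =>
      (closed_continuousOn_Uk ht.1).2 (ht.2 x (Metric.closedBall_subset_closedBall hRε hx))⟩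
  · refine ⟨fun t => ‖ub t‖ + |δ₀| + ∑ i, ‖w i t‖, ?_, ae_of_all _ fun t v hv => ?_⟩
    · exact (hfeas.1.1.norm.add (memLp_const _)).add (memLp_finsetSum _ fun i _ => (hwL i).norm)
    · rcases hv with hv | ⟨i, rfl⟩
      · have h1 : ‖v - ub t‖ ≤ δ₀ := by simpa [dist_eq_norm] using hv.1
        have h2 := norm_le_norm_add_norm_sub (ub t) v
        have h3 : 0 ≤ ∑ i, ‖w i t‖ := Finset.sum_nonneg fun _ _ => norm_nonneg _
        have h4 := le_abs_self δ₀
        rw [norm_sub_rev] at h2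
        linarith [norm_sub_rev v (ub t)]
      · have h3 : ‖w i t‖ ≤ ∑ i, ‖w i t‖ :=
          Finset.single_le_sum (f := fun i => ‖w i t‖) (fun _ _ => norm_nonneg _)
            (Finset.mem_univ i)
        have h4 := norm_nonneg (ub t)
        have h5 := abs_nonneg δ₀
        dsimp only
        linarith

end OCProblem

/-! ### Existence of trajectories near approximate trajectories -/

/-- The iterated integrals of a nonnegative summable function are the divided powers of its
primitive. -/
theorem integral_mul_primitive_pow {κ : ℝ → ℝ} {t : ℝ} (hκ : IntervalIntegrable κ volume 0 t)
    (m : ℕ) :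
    ∫ s in (0 : ℝ)..t, κ s * (∫ r in (0 : ℝ)..s, κ r) ^ m =
      (∫ r in (0 : ℝ)..t, κ r) ^ (m + 1) / (m + 1) := by
  set q : ℝ → ℝ := fun s => ∫ r in (0 : ℝ)..s, κ r with hq
  have hqac : AbsolutelyContinuousOnInterval q 0 t :=
    hκ.absolutelyContinuousOnInterval_intervalIntegral left_mem_uIcc
  have hpow : ∀ j : ℕ, AbsolutelyContinuousOnInterval (fun s => q s ^ (j + 1)) 0 t := by
    intro j
    induction j with
    | zero => simpa using hqac
    | succ j ih =>
      have := ih.fun_mul hqac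
      simpa [pow_succ] using this
  have h1 := (hpow m).integral_deriv_eq_sub
  have h0 : q 0 = 0 := by simp [hq]
  have h2 : ∫ s in (0 : ℝ)..t, deriv (fun s => q s ^ (m + 1)) s =
      ∫ s in (0 : ℝ)..t, ((m : ℝ) + 1) * (κ s * q s ^ m) := by
    refine intervalIntegral.integral_congr_ae ?_
    filter_upwards [hκ.ae_hasDerivAt_integral] with s hs hmem
    have hd : HasDerivAt q (κ s) s := hs (uIoc_subset_uIcc hmem) 0 left_mem_uIcc
    have := (hd.pow (m + 1)).deriv
    simp only [Nat.cast_add, Nat.cast_one, Nat.add_sub_cancel] at this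
    rw [show (fun s => q s ^ (m + 1)) = q ^ (m + 1) from rfl, this]
    ring
  rw [h2, intervalIntegral.integral_const_mul] at h1
  have hm : (m : ℝ) + 1 ≠ 0 := by positivity
  rw [eq_div_iff hm, mul_comm]
  simpa [h0] using h1

namespace OCProblem

variable {n m r : ℕ} {P : OCProblem n m r} {xb : ℝ → Euc n} {V : ℝ → Set (Euc m)} {R : ℝ}
  {κ : ℝ → ℝ}

namespace TubeRegular

variable (H : P.TubeRegular xb V R κ)
include H

theorem lipschitz {u : ℝ → Euc m} (hu : u ∈ P.Selections V) {x y : ℝ → Euc n}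
    (hx : x ∈ P.Tube xb R) (hy : y ∈ P.Tube xb R) :
    ∀ᵐ t ∂P.leb, ‖P.f t (x t) (u t) - P.f t (y t) (u t)‖ ≤ κ t * ‖x t - y t‖ := by
  filter_upwards [H.bound, hu.2, P.ae_leb_iff.2 (ae_of_all _ fun t ht => ht)] with t h1 h2 h3
  exact (h1 _ h2).2 _ (by simpa [dist_eq_norm] using hx.2 t h3) _
    (by simpa [dist_eq_norm] using hy.2 t h3)

theorem center_mem : xb ∈ P.Tube xb R :=
  ⟨H.continuousOn, fun t _ => by simpa using H.pos.le⟩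

theorem norm_velocity_le {u : ℝ → Euc m} (hu : u ∈ P.Selections V) {x : ℝ → Euc n}
    (hx : x ∈ P.Tube xb R) : ∀ᵐ t ∂P.leb, ‖P.f t (x t) (u t)‖ ≤ κ t * (1 + R) := by
  filter_upwards [H.bound, hu.2, H.lipschitz hu hx H.center_mem,
    P.ae_leb_iff.2 (ae_of_all _ fun t ht => ht)] with t h1 h2 h3 h4
  have h5 := norm_le_norm_add_norm_sub (P.f t (xb t) (u t)) (P.f t (x t) (u t))
  rw [norm_sub_rev] at h5
  have h6 := mul_le_mul_of_nonneg_left (hx.2 t h4) (H.nonneg t)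
  linarith [(h1 _ h2).1, norm_sub_rev (P.f t (x t) (u t)) (P.f t (xb t) (u t))]

theorem integrable_velocity {u : ℝ → Euc m} (hu : u ∈ P.Selections V) {x : ℝ → Euc n}
    (hx : x ∈ P.Tube xb R) : Integrable (fun t => P.f t (x t) (u t)) P.leb :=
  (H.integrable.mul_const (1 + R)).mono' (H.measurable u hu x hx) (H.norm_velocity_le hu hx)

theorem memLp_control {u : ℝ → Euc m} (hu : u ∈ P.Selections V) : MemLp u ⊤ P.leb := by
  obtain ⟨b, hb, hbV⟩ := H.bounded
  refine hb.mono' hu.1.aestronglyMeasurable ?_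
  filter_upwards [hbV, hu.2] with t h1 h2
  exact h1 _ h2

theorem integrable_control {u : ℝ → Euc m} (hu : u ∈ P.Selections V) : Integrable u P.leb :=
  (H.memLp_control hu).integrable le_top

theorem mem_W11_of_integral {u : ℝ → Euc m} (hu : u ∈ P.Selections V) {x : ℝ → Euc n}
    (hx : x ∈ P.Tube xb R)
    (h : ∀ t ∈ Icc 0 P.T, x t = x 0 + ∫ s in (0 : ℝ)..t, P.f s (x s) (u s)) : P.SolvesODE x u :=
  solves_of_integral (H.integrable_velocity hu hx) h

theorem norm_integral_sub_le {u : ℝ → Euc m} (hu : u ∈ P.Selections V) {x y : ℝ → Euc n}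
    (hx : x ∈ P.Tube xb R) (hy : y ∈ P.Tube xb R) {c : ℝ → ℝ} {t : ℝ} (ht : t ∈ Icc 0 P.T)
    (hc : IntervalIntegrable (fun s => κ s * c s) volume 0 t)
    (hxy : ∀ s ∈ Icc 0 P.T, ‖x s - y s‖ ≤ c s) :
    ‖(∫ s in (0 : ℝ)..t, P.f s (x s) (u s)) - ∫ s in (0 : ℝ)..t, P.f s (y s) (u s)‖ ≤
      ∫ s in (0 : ℝ)..t, κ s * c s := by
  rw [← intervalIntegral.integral_sub (intervalIntegrable_of_leb (H.integrable_velocity hu hx) ht)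
    (intervalIntegrable_of_leb (H.integrable_velocity hu hy) ht)]
  refine intervalIntegral.norm_integral_le_of_norm_le ht.1 ?_ hc
  filter_upwards [P.ae_leb_iff.1 (H.lipschitz hu hx hy)] with s hs hmem
  have hs' : s ∈ Icc 0 P.T := ⟨hmem.1.le, hmem.2.trans ht.2⟩
  exact (hs hs').trans (mul_le_mul_of_nonneg_left (hxy s hs') (H.nonneg s))

/-- Filippov's lemma: near a curve which solves the integral equation up to an error `e` there is
a trajectory, at distance at most `e * exp (∫ κ)`. It is the limit of the Picard iterates starting
from the curve, whose successive differences are bounded by `e (∫₀ᵗ κ) ^ i / i!`. -/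
theorem exists_trajectory_near {u : ℝ → Euc m} (hu : u ∈ P.Selections V) {x : ℝ → Euc n}
    (hx : x ∈ P.Tube xb R) {e : ℝ} (he : 0 ≤ e)
    (hdef : ∀ t ∈ Icc 0 P.T, ‖x t - (x 0 + ∫ s in (0 : ℝ)..t, P.f s (x s) (u s))‖ ≤ e)
    (hmargin : ∀ t ∈ Icc 0 P.T, ‖x t - xb t‖ + e * Real.exp (∫ s, κ s ∂P.leb) ≤ R) :
    ∃ y ∈ P.Tube xb R, P.SolvesODE y u ∧ y 0 = x 0 ∧
      ∀ t ∈ Icc 0 P.T, ‖y t - x t‖ ≤ e * Real.exp (∫ s, κ s ∂P.leb) := by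
  set A := ∫ s, κ s ∂P.leb with hA
  set q : ℝ → ℝ := fun t => ∫ s in (0 : ℝ)..t, κ s with hq
  have hq0 : ∀ t ∈ Icc 0 P.T, 0 ≤ q t := fun t ht =>
    intervalIntegral.integral_nonneg ht.1 fun s _ => H.nonneg s
  have hqA : ∀ t ∈ Icc 0 P.T, q t ≤ A := fun t ht => by
    have := norm_integral_le_leb H.integrable ht
    rw [Real.norm_eq_abs, abs_of_nonneg (hq0 t ht)] at this
    simpa [Real.norm_eq_abs, abs_of_nonneg (H.nonneg _)] using this
  have hqc : ContinuousOn q (Icc 0 P.T) := by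
    rw [← P.uIcc_T]
    exact intervalIntegral.continuousOn_primitive_interval'
      (P.integrable_leb_iff.1 H.integrable) left_mem_uIcc
  have h0T : (0 : ℝ) ∈ Icc 0 P.T := ⟨le_rfl, P.T_pos.le⟩
  let Y : ℕ → ℝ → Euc n := fun i => Nat.rec x
    (fun _ y t => x 0 + ∫ s in (0 : ℝ)..t, P.f s (y s) (u s)) i
  have hYs : ∀ i t, Y (i + 1) t = x 0 + ∫ s in (0 : ℝ)..t, P.f s (Y i s) (u s) := fun _ _ => rfl
  have hcontY : ∀ i, Y i ∈ P.Tube xb R → ContinuousOn (Y (i + 1)) (Icc 0 P.T) := by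
    intro i hi
    refine continuousOn_const.add ?_
    rw [← P.uIcc_T]
    exact intervalIntegral.continuousOn_primitive_interval'
      (P.integrable_leb_iff.1 (H.integrable_velocity hu hi)) left_mem_uIcc
  have key : ∀ i, Y i ∈ P.Tube xb R ∧
      (∀ t ∈ Icc 0 P.T, ‖Y i t - x t‖ ≤ e * ∑ j ∈ Finset.range i, q t ^ j / j.factorial) ∧
      ∀ t ∈ Icc 0 P.T, ‖Y (i + 1) t - Y i t‖ ≤ e * (q t ^ i / i.factorial) := by
    intro i
    induction i with
    | zero =>
      refine ⟨hx, fun t _ => by simp [Y], fun t ht => ?_⟩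
      rw [norm_sub_rev, pow_zero, Nat.factorial_zero, Nat.cast_one, div_one, mul_one]
      exact hdef t ht
    | succ i ih =>
      obtain ⟨h1, h2, h3⟩ := ih
      have h4 : ∀ t ∈ Icc 0 P.T,
          ‖Y (i + 1) t - x t‖ ≤ e * ∑ j ∈ Finset.range (i + 1), q t ^ j / j.factorial := by
        intro t ht
        rw [Finset.sum_range_succ, mul_add]
        have := norm_sub_le_norm_sub_add_norm_sub (Y (i + 1) t) (Y i t) (x t)
        linarith [h2 t ht, h3 t ht]
      have h5 : Y (i + 1) ∈ P.Tube xb R := by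
        refine ⟨hcontY i h1, fun t ht => ?_⟩
        have h6 := norm_sub_le_norm_sub_add_norm_sub (Y (i + 1) t) (x t) (xb t)
        have h7 := (Real.sum_le_exp_of_nonneg (hq0 t ht) (i + 1)).trans
          (Real.exp_le_exp.2 (hqA t ht))
        have h8 := mul_le_mul_of_nonneg_left h7 he
        linarith [h4 t ht, hmargin t ht]
      refine ⟨h5, h4, fun t ht => ?_⟩
      have hκt := intervalIntegrable_of_leb H.integrable ht
      have hint : IntervalIntegrable (fun s => κ s * (e * (q s ^ i / i.factorial))) volume 0 t := by
        refine hκt.mul_continuousOn ?_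
        refine continuousOn_const.mul (ContinuousOn.div_const (ContinuousOn.pow ?_ i) _)
        refine hqc.mono ?_
        rw [uIcc_of_le ht.1]
        exact Icc_subset_Icc le_rfl ht.2
      have h6 := H.norm_integral_sub_le hu h5 h1 ht hint h3
      rw [hYs (i + 1), hYs i, add_sub_add_left_eq_sub]
      refine h6.trans (le_of_eq ?_)
      have h7 := integral_mul_primitive_pow hκt i
      have h8 : ∀ s, κ s * (e * (q s ^ i / i.factorial)) =
          (e / i.factorial) * (κ s * q s ^ i) := fun s => by ring
      simp_rw [h8]
      rw [intervalIntegral.integral_const_mul, h7, Nat.factorial_succ]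
      push_cast
      field_simp
      rfl
  have hsum : Summable fun i : ℕ => e * (A ^ i / i.factorial) :=
    (Real.summable_pow_div_factorial A).mul_left e
  have hdist : ∀ t ∈ Icc 0 P.T, ∀ i, dist (Y i t) (Y (i + 1) t) ≤ e * (A ^ i / i.factorial) := by
    intro t ht i
    rw [dist_comm, dist_eq_norm]
    refine ((key i).2.2 t ht).trans ?_
    have h1 := hq0 t ht
    have h2 := hqA t ht
    gcongr
  have hlim : ∀ t, ∃ a, t ∈ Icc 0 P.T → Tendsto (fun i => Y i t) atTop (𝓝 a) := by
    intro t
    by_cases ht : t ∈ Icc 0 P.T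
    · obtain ⟨a, ha⟩ := cauchySeq_tendsto_of_complete
        (cauchySeq_of_dist_le_of_summable _ (hdist t ht) hsum)
      exact ⟨a, fun _ => ha⟩
    · exact ⟨0, fun h => absurd h ht⟩
  choose y hy using hlim
  set τ : ℕ → ℝ := fun i => ∑' j, e * (A ^ (i + j) / (i + j).factorial) with hτ
  have hτ0 : Tendsto τ atTop (𝓝 0) := by
    have := tendsto_sum_nat_add fun i : ℕ => e * (A ^ i / i.factorial)
    simpa [hτ, add_comm] using this
  have hYτ : ∀ t ∈ Icc 0 P.T, ∀ i, ‖Y i t - y t‖ ≤ τ i := fun t ht i => by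
    rw [← dist_eq_norm]
    exact dist_le_tsum_of_dist_le_of_tendsto _ (hdist t ht) hsum (hy t ht) i
  have hyc : ContinuousOn y (Icc 0 P.T) := by
    have hunif : TendstoUniformlyOn Y y atTop (Icc 0 P.T) := by
      rw [Metric.tendstoUniformlyOn_iff]
      intro ε hε
      filter_upwards [hτ0.eventually (gt_mem_nhds hε)] with i hi t ht
      rw [dist_comm, dist_eq_norm]
      exact (hYτ t ht i).trans_lt hi
    exact hunif.continuousOn (Frequently.of_forall fun i => (key i).1.1)
  have hyT : y ∈ P.Tube xb R := ⟨hyc, fun t ht =>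
    le_of_tendsto ((hy t ht).sub_const (xb t)).norm
      (Eventually.of_forall fun i => (key i).1.2 t ht)⟩
  have hyint : ∀ t ∈ Icc 0 P.T, y t = x 0 + ∫ s in (0 : ℝ)..t, P.f s (y s) (u s) := by
    intro t ht
    refine tendsto_nhds_unique ((tendsto_add_atTop_iff_nat 1).2 (hy t ht)) ?_
    simp_rw [hYs]
    refine tendsto_const_nhds.add (tendsto_iff_norm_sub_tendsto_zero.2 ?_)
    have hb : ∀ i, ‖(∫ s in (0 : ℝ)..t, P.f s (Y i s) (u s)) -
        ∫ s in (0 : ℝ)..t, P.f s (y s) (u s)‖ ≤ (∫ s in (0 : ℝ)..t, κ s) * τ i := by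
      intro i
      rw [← intervalIntegral.integral_mul_const]
      exact H.norm_integral_sub_le hu (key i).1 hyT ht
        ((intervalIntegrable_of_leb H.integrable ht).mul_const _) fun s hs => hYτ s hs i
    refine squeeze_zero (fun _ => norm_nonneg _) hb ?_
    simpa using hτ0.const_mul (∫ s in (0 : ℝ)..t, κ s)
  have hy0 : y 0 = x 0 := by simpa using hyint 0 h0T
  refine ⟨y, hyT, H.mem_W11_of_integral hu hyT (by rwa [hy0]), hy0, fun t ht => ?_⟩
  refine le_of_tendsto ((hy t ht).sub_const (x t)).norm (Eventually.of_forall fun i => ?_)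
  refine ((key i).2.1 t ht).trans (mul_le_mul_of_nonneg_left ?_ he)
  exact (Real.sum_le_exp_of_nonneg (hq0 t ht) i).trans (Real.exp_le_exp.2 (hqA t ht))

end TubeRegular

end OCProblem

/-! ### Rapidly oscillating switching sets -/

theorem abs_integral_le_one_of_periodic {p : ℝ → ℝ} (hp : Measurable p) (hp1 : ∀ s, |p s| ≤ 1)
    (hper : Function.Periodic p 1) (hmean : ∫ s in (0 : ℝ)..1, p s = 0) (t : ℝ) :
    |∫ s in (0 : ℝ)..t, p s| ≤ 1 := by
  have hii : ∀ a b, IntervalIntegrable p volume a b := fun a b =>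
    (intervalIntegrable_const (c := (1 : ℝ))).mono_fun' hp.aestronglyMeasurable
      (ae_of_all _ fun s => hp1 s)
  have h1 := hper.intervalIntegral_add_zsmul_eq ⌊t⌋ 0 hii
  simp only [zero_add, hmean, smul_zero, zsmul_eq_mul, mul_one] at h1
  rw [← intervalIntegral.integral_add_adjacent_intervals (hii 0 ⌊t⌋) (hii ⌊t⌋ t), h1, zero_add]
  have h2 := intervalIntegral.norm_integral_le_of_norm_le_const (a := (⌊t⌋ : ℝ)) (b := t)
    (f := p) (C := 1) fun s _ => hp1 s
  rw [Real.norm_eq_abs, one_mul, abs_of_nonneg (sub_nonneg.2 (Int.floor_le t))] at h2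
  linarith [Int.lt_floor_add_one t]

namespace OCProblem

variable {n m r : ℕ} {P : OCProblem n m r}

/-- Riemann–Lebesgue lemma for rescalings of a periodic function of mean zero, uniform with
respect to the upper limit of integration. For smooth `h` it follows by integration by parts, as
the primitive of `s ↦ p (N s)` is of order `1 / N`. -/
theorem eventually_abs_integral_oscillating_le {p : ℝ → ℝ} (hp : Measurable p)
    (hp1 : ∀ s, |p s| ≤ 1) (hper : Function.Periodic p 1) (hmean : ∫ s in (0 : ℝ)..1, p s = 0)
    {h : ℝ → ℝ} (hh : Integrable h P.leb) {ε : ℝ} (hε : 0 < ε) :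
    ∀ᶠ N : ℕ in atTop, ∀ t ∈ Icc 0 P.T, |∫ s in (0 : ℝ)..t, p (N * s) * h s| ≤ ε := by
  obtain ⟨g, hgs, hgd, hgε⟩ := (memLp_one_iff_integrable.2 hh).exist_eLpNorm_sub_le
    (by simp) le_rfl (half_pos hε)
  have hgi : Integrable g P.leb :=
    (hgd.continuous.integrable_of_hasCompactSupport hgs).mono_measure Measure.restrict_le_self
  have hdist : ∫ s, ‖h s - g s‖ ∂P.leb ≤ ε / 2 := by
    have h1 := hh.sub hgi
    rw [eLpNorm_one_eq_lintegral_enorm] at hgε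
    have h2 := integral_norm_eq_lintegral_enorm h1.aestronglyMeasurable
    simp only [Pi.sub_apply] at h2 hgε
    rw [h2]
    exact ENNReal.toReal_le_of_le_ofReal (half_pos hε).le hgε
  have hg'c : Continuous (deriv g) := hgd.continuous_deriv (by simp)
  obtain ⟨C₀, hC₀⟩ := hgs.exists_bound_of_continuous hgd.continuous
  obtain ⟨C₁, hC₁⟩ := hgs.deriv.exists_bound_of_continuous hg'c
  have hC0 : 0 ≤ C₀ := (norm_nonneg _).trans (hC₀ 0)
  have hC1 : 0 ≤ C₁ := (norm_nonneg _).trans (hC₁ 0)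
  have hT := P.T_pos
  have hlim : Tendsto (fun N : ℕ => (N : ℝ)⁻¹ * (C₀ + C₁ * P.T)) atTop (𝓝 0) := by
    simpa using tendsto_natCast_atTop_atTop.inv_tendsto_atTop.mul_const (C₀ + C₁ * P.T)
  filter_upwards [hlim.eventually (ge_mem_nhds (half_pos hε)), eventually_gt_atTop 0]
    with N hN hN0 t ht
  have hN0' : (0 : ℝ) < N := Nat.cast_pos.2 hN0
  have hpN : Measurable fun s : ℝ => p (N * s) := hp.comp (measurable_const_mul _)
  have hpii : ∀ a b, IntervalIntegrable (fun s => p (N * s)) volume a b := fun a b =>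
    (intervalIntegrable_const (c := (1 : ℝ))).mono_fun' hpN.aestronglyMeasurable
      (ae_of_all _ fun s => hp1 _)
  set c : ℝ → ℝ := fun t => ∫ s in (0 : ℝ)..t, p (N * s) with hc
  have hcN : ∀ t, |c t| ≤ (N : ℝ)⁻¹ := by
    intro t
    rw [hc]
    dsimp only
    rw [intervalIntegral.integral_comp_mul_left _ hN0'.ne', mul_zero, smul_eq_mul, abs_mul,
      abs_of_pos (inv_pos.2 hN0')]
    exact mul_le_of_le_one_right (inv_pos.2 hN0').le
      (abs_integral_le_one_of_periodic hp hp1 hper hmean _)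
  have hcac : AbsolutelyContinuousOnInterval c 0 t :=
    (hpii 0 t).absolutelyContinuousOnInterval_intervalIntegral left_mem_uIcc
  have hgac : AbsolutelyContinuousOnInterval g 0 t :=
    ((hgd.of_le (by simp : (1 : WithTop ℕ∞) ≤ _)).contDiffOn).absolutelyContinuousOnInterval
  have hgii : IntervalIntegrable g volume 0 t := hgd.continuous.intervalIntegrable _ _
  have hpg : IntervalIntegrable (fun s => p (N * s) * g s) volume 0 t :=
    (hpii 0 t).mul_continuousOn hgd.continuous.continuousOn
  have hcg : IntervalIntegrable (fun s => c s * deriv g s) volume 0 t :=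
    (hcac.continuousOn.mul hg'c.continuousOn).intervalIntegrable
  have hparts : ∫ s in (0 : ℝ)..t, p (N * s) * g s =
      c t * g t - ∫ s in (0 : ℝ)..t, c s * deriv g s := by
    have h1 := hcac.integral_deriv_mul_eq_sub hgac
    have h2 : ∫ s in (0 : ℝ)..t, (deriv c s * g s + c s * deriv g s) =
        ∫ s in (0 : ℝ)..t, (p (N * s) * g s + c s * deriv g s) := by
      refine intervalIntegral.integral_congr_ae ?_
      filter_upwards [(hpii 0 t).ae_hasDerivAt_integral] with s hs hmem
      rw [(hs (uIoc_subset_uIcc hmem) 0 left_mem_uIcc).deriv]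
    rw [h2, intervalIntegral.integral_add hpg hcg] at h1
    have h3 : c 0 = 0 := by simp [hc]
    rw [h3] at h1
    linarith
  have hsmooth : |∫ s in (0 : ℝ)..t, p (N * s) * g s| ≤ ε / 2 := by
    rw [hparts]
    have h1 : |c t * g t| ≤ (N : ℝ)⁻¹ * C₀ := by
      rw [abs_mul]
      exact mul_le_mul (hcN t) (hC₀ t) (abs_nonneg _) (inv_pos.2 hN0').le
    have h2 : |∫ s in (0 : ℝ)..t, c s * deriv g s| ≤ (N : ℝ)⁻¹ * C₁ * P.T := by
      have := intervalIntegral.norm_integral_le_of_norm_le_const (a := 0) (b := t)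
        (f := fun s => c s * deriv g s) (C := (N : ℝ)⁻¹ * C₁) fun s _ => by
          rw [norm_mul]
          exact mul_le_mul (hcN s) (hC₁ s) (norm_nonneg _) (inv_pos.2 hN0').le
      refine this.trans (mul_le_mul_of_nonneg_left ?_ (by positivity))
      rw [sub_zero, abs_of_nonneg ht.1]
      exact ht.2
    have h3 := abs_sub (c t * g t) (∫ s in (0 : ℝ)..t, c s * deriv g s)
    have h4 : (N : ℝ)⁻¹ * (C₀ + C₁ * P.T) = (N : ℝ)⁻¹ * C₀ + (N : ℝ)⁻¹ * C₁ * P.T := by ring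
    linarith
  have hhg : Integrable (fun s => p (N * s) * (h s - g s)) P.leb :=
    (hh.sub hgi).bdd_mul hpN.aestronglyMeasurable (ae_of_all _ fun s => hp1 _)
  have hrest : |∫ s in (0 : ℝ)..t, p (N * s) * (h s - g s)| ≤ ε / 2 := by
    refine (norm_integral_le_leb hhg ht).trans (le_trans ?_ hdist)
    refine integral_mono hhg.norm (hh.sub hgi).norm fun s => ?_
    rw [norm_mul]
    exact mul_le_of_le_one_left (norm_nonneg _) (hp1 _)
  have hsplit : ∫ s in (0 : ℝ)..t, p (N * s) * h s =
      (∫ s in (0 : ℝ)..t, p (N * s) * g s) + ∫ s in (0 : ℝ)..t, p (N * s) * (h s - g s) := by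
    rw [← intervalIntegral.integral_add hpg (intervalIntegrable_of_leb hhg ht)]
    congr 1
    funext s
    ring
  rw [hsplit]
  linarith [abs_add_le (∫ s in (0 : ℝ)..t, p (N * s) * g s)
    (∫ s in (0 : ℝ)..t, p (N * s) * (h s - g s))]

theorem eventually_norm_integral_oscillating_le {p : ℝ → ℝ} (hp : Measurable p)
    (hp1 : ∀ s, |p s| ≤ 1) (hper : Function.Periodic p 1) (hmean : ∫ s in (0 : ℝ)..1, p s = 0)
    {h : ℝ → Euc n} (hh : Integrable h P.leb) {ε : ℝ} (hε : 0 < ε) :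
    ∀ᶠ N : ℕ in atTop, ∀ t ∈ Icc 0 P.T, ‖∫ s in (0 : ℝ)..t, p (N * s) • h s‖ ≤ ε := by
  have hδ : 0 < ε / (n + 1) := by positivity
  have hcoord : ∀ l : Fin n, Integrable (fun s => h s l) P.leb := fun l =>
    (EuclideanSpace.proj (𝕜 := ℝ) l).integrable_comp hh
  filter_upwards [eventually_all.2 fun l =>
    eventually_abs_integral_oscillating_le hp hp1 hper hmean (hcoord l) hδ] with N hN t ht
  have hi : IntervalIntegrable (fun s => p (N * s) • h s) volume 0 t :=
    intervalIntegrable_of_leb (hh.bdd_smul 1 (hp.comp (measurable_const_mul _)).aestronglyMeasurable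
      (ae_of_all _ fun s => hp1 _)) ht
  have hl : ∀ l, ‖(∫ s in (0 : ℝ)..t, p (N * s) • h s) l‖ ≤ ε / (n + 1) := by
    intro l
    have : (∫ s in (0 : ℝ)..t, p (N * s) • h s) l = ∫ s in (0 : ℝ)..t, p (N * s) * h s l :=
      ((EuclideanSpace.proj (𝕜 := ℝ) l).intervalIntegral_comp_comm hi).symm
    rw [this]
    exact hN l t ht
  have hsum : ∀ v : Euc n, ‖v‖ ≤ ∑ l, ‖v l‖ := by
    intro v
    have hv : v = ∑ l, EuclideanSpace.single l (v l) := by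
      ext i
      simp
    calc ‖v‖ = ‖∑ l, EuclideanSpace.single l (v l)‖ := by rw [← hv]
      _ ≤ ∑ l, ‖EuclideanSpace.single l (v l)‖ := norm_sum_le _ _
      _ = ∑ l, ‖v l‖ := by simp
  refine (hsum _).trans ((Finset.sum_le_sum fun l _ => hl l).trans ?_)
  rw [Finset.sum_const, Finset.card_univ, Fintype.card_fin, nsmul_eq_mul, mul_div_assoc',
    div_le_iff₀ (by positivity)]
  nlinarith

/-- Chattering sets: disjoint measurable sets of prescribed densities `α i`, so finely mixed that
replacing the weights `α i` by the indicators of the sets changes given integrals by less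
than `ε`. -/
theorem exists_chattering {k : ℕ} {α : Fin k → ℝ} (hα0 : ∀ i, 0 ≤ α i) (hα1 : ∑ i, α i ≤ 1)
    {h : Fin k → ℝ → Euc n} (hh : ∀ i, Integrable (h i) P.leb)
    {q : Fin k → ℝ → ℝ} (hq : ∀ i, Integrable (q i) P.leb) {ε : ℝ} (hε : 0 < ε) :
    ∃ A : Fin k → Set ℝ, (∀ i, MeasurableSet (A i)) ∧ Pairwise (fun i j => Disjoint (A i) (A j)) ∧
      ∀ i, ∀ t ∈ Icc 0 P.T,
        ‖∫ s in (0 : ℝ)..t, ((A i).indicator 1 s - α i) • h i s‖ ≤ ε ∧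
        |∫ s in (0 : ℝ)..t, ((A i).indicator 1 s - α i) * q i s| ≤ ε := by
  -- Consecutive subintervals of `[0, 1)` of lengths `α i`, repeated with period `1 / N`.
  let a : Fin k → ℝ := fun i => ∑ l with l < i, α l
  have hab : ∀ i j, i < j → a i + α i ≤ a j := by
    intro i j hij
    have : a i + α i = ∑ l with l ≤ i, α l := by
      have hins : (Finset.univ.filter fun l => l ≤ i) =
          insert i (Finset.univ.filter fun l => l < i) := by
        ext l
        simp [le_iff_eq_or_lt]
      rw [hins, Finset.sum_insert (by simp), add_comm]
    rw [this]
    refine Finset.sum_le_sum_of_subset_of_nonneg (fun l hl => ?_) fun l _ _ => hα0 l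
    simp only [Finset.mem_filter, Finset.mem_univ, true_and] at hl ⊢
    exact hl.trans_lt hij
  have ha0 : ∀ i, 0 ≤ a i := fun i => Finset.sum_nonneg fun l _ => hα0 l
  have ha1 : ∀ i, a i + α i ≤ 1 := by
    intro i
    refine le_trans ?_ hα1
    have hnot : i ∉ Finset.univ.filter fun l => l < i := by simp
    rw [add_comm, ← Finset.sum_insert hnot]
    exact Finset.sum_le_sum_of_subset_of_nonneg (Finset.subset_univ _) fun l _ _ => hα0 l
  let p : Fin k → ℝ → ℝ := fun i s => (Ico (a i) (a i + α i)).indicator 1 (Int.fract s) - α i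
  have hpm : ∀ i, Measurable (p i) := fun i =>
    ((measurable_one.indicator measurableSet_Ico).comp measurable_fract).sub_const _
  have hp1 : ∀ i s, |p i s| ≤ 1 := by
    intro i s
    have h1 : α i ≤ 1 := by linarith [ha0 i, ha1 i]
    have h0 := hα0 i
    by_cases hs : Int.fract s ∈ Ico (a i) (a i + α i)
    · simp only [p, indicator_of_mem hs, Pi.one_apply]
      rw [abs_le]
      constructor <;> linarith
    · simp only [p, indicator_of_notMem hs]
      rw [abs_le]
      constructor <;> linarith
  have hper : ∀ i, Function.Periodic (p i) 1 := fun i s => by simp [p]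
  have hmean : ∀ i, ∫ s in (0 : ℝ)..1, p i s = 0 := by
    intro i
    have h1 : ∫ s in (0 : ℝ)..1, p i s =
        ∫ s in Ico (0 : ℝ) 1, ((Ico (a i) (a i + α i)).indicator 1 s - α i) := by
      rw [intervalIntegral.integral_of_le zero_le_one, ← integral_Ico_eq_integral_Ioc]
      refine setIntegral_congr_fun measurableSet_Ico fun s hs => ?_
      simp only [p, Int.fract_eq_self.2 ⟨hs.1, hs.2⟩]
    have hsub : Ico (a i) (a i + α i) ⊆ Ico 0 1 := Ico_subset_Ico (ha0 i) (ha1 i)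
    have hfi : IntegrableOn ((Ico (a i) (a i + α i)).indicator (1 : ℝ → ℝ)) (Ico 0 1) :=
      (integrable_const (1 : ℝ)).indicator measurableSet_Ico
    rw [h1, integral_sub hfi (integrable_const _), setIntegral_indicator measurableSet_Ico,
      inter_eq_self_of_subset_right hsub]
    simp [hα0 i]
  obtain ⟨N, hN⟩ := (eventually_all.2 fun i =>
    (eventually_norm_integral_oscillating_le (hpm i) (hp1 i) (hper i) (hmean i) (hh i) hε).and
    (eventually_abs_integral_oscillating_le (hpm i) (hp1 i) (hper i) (hmean i) (hq i) hε)).exists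
  have hind : ∀ i s, ((fun s : ℝ => Int.fract (N * s)) ⁻¹' Ico (a i) (a i + α i)).indicator
      (1 : ℝ → ℝ) s - α i = p i (N * s) := by
    intro i s
    simp only [p, indicator, mem_preimage, Pi.one_apply]
  refine ⟨fun i => (fun s => Int.fract (N * s)) ⁻¹' Ico (a i) (a i + α i), fun i => ?_, ?_, ?_⟩
  · exact (measurable_fract.comp (measurable_const_mul (N : ℝ))) measurableSet_Ico
  · intro i j hij
    refine Disjoint.preimage _ ?_
    rcases lt_or_gt_of_ne hij with h | h
    · exact disjoint_left.2 fun s hs hs' => by linarith [hs.2, hs'.1, hab i j h]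
    · exact disjoint_left.2 fun s hs hs' => by linarith [hs.1, hs'.2, hab j i h]
  · intro i t ht
    simp_rw [hind]
    exact ⟨(hN i).1 t ht, (hN i).2 t ht⟩

end OCProblem

/-! ### Ekeland's variational principle -/

/-- Ekeland's variational principle, for a pseudo-distance `D` given as a function on a set `A`
that is complete for it, and for a nonnegative continuous function `F`. -/
theorem exists_ekeland_point {α : Type*} {A : Set α} {D : α → α → ℝ}
    (hself : ∀ p ∈ A, D p p = 0) (hsymm : ∀ p q, D p q = D q p)
    (htri : ∀ p ∈ A, ∀ q ∈ A, ∀ o ∈ A, D p o ≤ D p q + D q o)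
    (hcomplete : ∀ s : ℕ → α, (∀ i, s i ∈ A) →
      (∀ ε > 0, ∃ N, ∀ i ≥ N, ∀ j ≥ N, D (s i) (s j) < ε) →
      ∃ p ∈ A, Tendsto (fun i => D (s i) p) atTop (𝓝 0))
    {F : α → ℝ} (hF0 : ∀ p ∈ A, 0 ≤ F p)
    (hF : ∀ s : ℕ → α, (∀ i, s i ∈ A) → ∀ p ∈ A,
      Tendsto (fun i => D (s i) p) atTop (𝓝 0) → Tendsto (fun i => F (s i)) atTop (𝓝 (F p)))
    {c : ℝ} (hc : 0 < c) {p₀ : α} (hp₀ : p₀ ∈ A) :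
    ∃ p ∈ A, F p + c * D p p₀ ≤ F p₀ ∧ ∀ q ∈ A, F p ≤ F q + c * D q p := by
  let S : α → Set α := fun p => {q | q ∈ A ∧ F q + c * D q p ≤ F p}
  have hSself : ∀ p ∈ A, p ∈ S p := fun p hp => ⟨hp, by simp [hself p hp]⟩
  have hStrans : ∀ p ∈ A, ∀ q ∈ S p, ∀ o ∈ S q, o ∈ S p := by
    intro p hp q hq o ho
    refine ⟨ho.1, ?_⟩
    have h1 := mul_le_mul_of_nonneg_left (htri o ho.1 q hq.1 p hp) hc.le
    linarith [hq.2, ho.2]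
  have hnext : ∀ (i : ℕ) (p : A), ∃ q : A, (q : α) ∈ S p ∧
      ∀ o ∈ S p, F q ≤ F o + 1 / ((i : ℝ) + 1) := by
    intro i p
    have hne : (F '' S p).Nonempty := ⟨_, p, hSself p p.2, rfl⟩
    have hbdd : BddBelow (F '' S p) := ⟨0, by rintro _ ⟨q, hq, rfl⟩; exact hF0 q hq.1⟩
    obtain ⟨_, ⟨q, hq, rfl⟩, hlt⟩ := exists_lt_of_csInf_lt hne
      (lt_add_of_pos_right (sInf (F '' S p)) (Nat.one_div_pos_of_nat (n := i) (α := ℝ)))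
    exact ⟨⟨q, hq.1⟩, hq, fun o ho => hlt.le.trans
      (add_le_add_left (csInf_le hbdd ⟨o, ho, rfl⟩) _)⟩
  choose next hnextS hnextF using hnext
  obtain ⟨s, hs0, hs⟩ : ∃ s : ℕ → A, s 0 = ⟨p₀, hp₀⟩ ∧ ∀ i, s (i + 1) = next i (s i) :=
    ⟨fun i => Nat.rec ⟨p₀, hp₀⟩ next i, rfl, fun _ => rfl⟩
  have hmono : ∀ i j, i ≤ j → (s j : α) ∈ S (s i) := by
    intro i j hij
    induction j, hij using Nat.le_induction with
    | base => exact hSself _ (s i).2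
    | succ j _ ih =>
      refine hStrans _ (s i).2 _ ih _ ?_
      rw [hs j]
      exact hnextS j (s j)
  have hDnn : ∀ p ∈ A, ∀ q ∈ A, 0 ≤ D p q := by
    intro p hp q hq
    have := htri p hp q hq p hp
    rw [hself p hp, hsymm q p] at this
    linarith
  have hanti : Antitone fun i => F (s i) := fun i j hij => by
    have h1 := (hmono i j hij).2
    have h2 := mul_nonneg hc.le (hDnn _ (s j).2 _ (s i).2)
    dsimp only
    linarith
  have hconv := tendsto_atTop_ciInf hanti ⟨0, by rintro _ ⟨i, rfl⟩; exact hF0 _ (s i).2⟩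
  have hcauchy : ∀ ε > 0, ∃ N, ∀ i ≥ N, ∀ j ≥ N, D (s i) (s j) < ε := by
    intro ε hε
    obtain ⟨N, hN⟩ := Metric.cauchySeq_iff.1 hconv.cauchySeq (c * ε) (by positivity)
    have key : ∀ i ≥ N, ∀ j ≥ N, i ≤ j → D (s j) (s i) < ε := by
      intro i hi j hj hij
      have h1 := (hmono i j hij).2
      have h2 := (le_abs_self _).trans_lt (hN i hi j hj)
      exact lt_of_mul_lt_mul_left (by linarith) hc.le
    refine ⟨N, fun i hi j hj => ?_⟩
    rcases le_total i j with h | h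
    · rw [hsymm]; exact key i hi j hj h
    · exact key j hj i hi h
  obtain ⟨p, hp, hlim⟩ := hcomplete (fun i => s i) (fun i => (s i).2) hcauchy
  have hFlim := hF (fun i => s i) (fun i => (s i).2) p hp hlim
  have hpS : ∀ i, p ∈ S (s i) := by
    intro i
    refine ⟨hp, ?_⟩
    have h1 : Tendsto (fun j => F (s j) + c * D p (s i) - c * D (s j) p) atTop
        (𝓝 (F p + c * D p (s i) - c * 0)) := (hFlim.add_const _).sub (hlim.const_mul c)
    rw [mul_zero, sub_zero] at h1
    refine le_of_tendsto h1 ?_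
    filter_upwards [eventually_ge_atTop i] with j hj
    have h2 := mul_le_mul_of_nonneg_left (htri p hp _ (s j).2 _ (s i).2) hc.le
    rw [hsymm p (s j)] at h2
    linarith [(hmono i j hj).2]
  have hstart := (hpS 0).2
  rw [hs0] at hstart
  refine ⟨p, hp, hstart, fun q hq => ?_⟩
  by_contra! hlt
  have hqS : q ∈ S p := ⟨hq, hlt.le⟩
  have hle : F p ≤ F q := by
    have h1 : Tendsto (fun i : ℕ => F q + 1 / ((i : ℝ) + 1)) atTop (𝓝 (F q + 0)) :=
      tendsto_one_div_add_atTop_nhds_zero_nat.const_add _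
    rw [add_zero] at h1
    refine le_of_tendsto_of_tendsto' ((tendsto_add_atTop_iff_nat 1).2 hFlim) h1 fun i => ?_
    exact hs i ▸ hnextF i (s i) q (hStrans _ (s i).2 _ (hpS i) _ hqS)
  linarith [mul_nonneg hc.le (hDnn q hq p hp)]

/-! ### The space of processes -/

namespace OCProblem

variable {n m r : ℕ} (P : OCProblem n m r)

instance nonempty_Icc_T : Nonempty (Icc (0 : ℝ) P.T) := ⟨⟨0, le_rfl, P.T_pos.le⟩⟩

theorem le_normC {x : ℝ → Euc n} (hx : ContinuousOn x (Icc 0 P.T)) {t : ℝ} (ht : t ∈ Icc 0 P.T) :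
    ‖x t‖ ≤ P.normC x := by
  obtain ⟨C, hC⟩ := isCompact_Icc.exists_bound_of_continuousOn hx
  exact le_ciSup (f := fun t : Icc (0 : ℝ) P.T => ‖x t‖)
    ⟨C, by rintro _ ⟨s, rfl⟩; exact hC s s.2⟩ ⟨t, ht⟩

theorem normC_le {x : ℝ → Euc n} {c : ℝ} (h : ∀ t ∈ Icc 0 P.T, ‖x t‖ ≤ c) : P.normC x ≤ c :=
  ciSup_le fun t => h t t.2

theorem normC_nonneg (x : ℝ → Euc n) : 0 ≤ P.normC x := Real.iSup_nonneg fun _ => norm_nonneg _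

theorem normC_sub_comm (x y : ℝ → Euc n) :
    P.normC (fun t => x t - y t) = P.normC (fun t => y t - x t) := by
  simp only [normC, norm_sub_rev]

theorem normC_triangle {x y z : ℝ → Euc n} (hx : ContinuousOn x (Icc 0 P.T))
    (hy : ContinuousOn y (Icc 0 P.T)) (hz : ContinuousOn z (Icc 0 P.T)) :
    P.normC (fun t => x t - z t) ≤ P.normC (fun t => x t - y t) + P.normC (fun t => y t - z t) :=
  P.normC_le fun t ht => (norm_sub_le_norm_sub_add_norm_sub _ (y t) _).trans
    (add_le_add (P.le_normC (hx.sub hy) ht) (P.le_normC (hy.sub hz) ht))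

theorem normL1_eq {d : ℕ} (v : ℝ → Euc d) : P.normL1 v = ∫ t, ‖v t‖ ∂P.leb :=
  P.intervalIntegral_eq_leb _

theorem normL1_nonneg {d : ℕ} (v : ℝ → Euc d) : 0 ≤ P.normL1 v := by
  rw [normL1_eq]; exact integral_nonneg fun _ => norm_nonneg _

theorem normL1_sub_comm {d : ℕ} (u v : ℝ → Euc d) :
    P.normL1 (fun t => u t - v t) = P.normL1 (fun t => v t - u t) := by
  simp only [normL1, norm_sub_rev]

theorem normL1_triangle {d : ℕ} {u v w : ℝ → Euc d} (hu : Integrable u P.leb)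
    (hv : Integrable v P.leb) (hw : Integrable w P.leb) :
    P.normL1 (fun t => u t - w t) ≤
      P.normL1 (fun t => u t - v t) + P.normL1 (fun t => v t - w t) := by
  simp only [normL1_eq]
  refine le_of_le_of_eq (integral_mono (hu.sub hw).norm ((hu.sub hv).norm.add (hv.sub hw).norm)
    fun t => norm_sub_le_norm_sub_add_norm_sub _ (v t) _)
    (integral_add (hu.sub hv).norm (hv.sub hw).norm)

/-- Control processes in the tube, with controls in `V`. -/
def Processes (xb : ℝ → Euc n) (V : ℝ → Set (Euc m)) (R : ℝ) :
    Set ((ℝ → Euc n) × (ℝ → Euc m)) :=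
  {z | z.1 ∈ P.Tube xb R ∧ z.2 ∈ P.Selections V ∧ P.SolvesODE z.1 z.2}

/-- The distance of `C([0, T]) × L¹`, on functions (so only a pseudo-distance). -/
def procDist (z z' : (ℝ → Euc n) × (ℝ → Euc m)) : ℝ :=
  P.normC (fun t => z.1 t - z'.1 t) + P.normL1 (fun t => z.2 t - z'.2 t)

theorem procDist_comm (z z' : (ℝ → Euc n) × (ℝ → Euc m)) : P.procDist z z' = P.procDist z' z := by
  unfold procDist
  rw [normC_sub_comm, normL1_sub_comm]

theorem procDist_self (z : (ℝ → Euc n) × (ℝ → Euc m)) : P.procDist z z = 0 := by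
  simp [procDist, normC, normL1]

theorem normC_le_procDist (z z' : (ℝ → Euc n) × (ℝ → Euc m)) :
    P.normC (fun t => z.1 t - z'.1 t) ≤ P.procDist z z' :=
  le_add_of_nonneg_right (P.normL1_nonneg _)

theorem normL1_le_procDist (z z' : (ℝ → Euc n) × (ℝ → Euc m)) :
    P.normL1 (fun t => z.2 t - z'.2 t) ≤ P.procDist z z' :=
  le_add_of_nonneg_left (P.normC_nonneg _)

variable {P} {xb : ℝ → Euc n} {V : ℝ → Set (Euc m)} {R : ℝ} {κ : ℝ → ℝ}

namespace TubeRegular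

variable (H : P.TubeRegular xb V R κ)
include H

theorem procDist_triangle {z z' z'' : (ℝ → Euc n) × (ℝ → Euc m)}
    (hz : z ∈ P.Processes xb V R) (hz' : z' ∈ P.Processes xb V R)
    (hz'' : z'' ∈ P.Processes xb V R) :
    P.procDist z z'' ≤ P.procDist z z' + P.procDist z' z'' := by
  unfold procDist
  have h1 := P.normC_triangle hz.1.1 hz'.1.1 hz''.1.1
  have h2 := P.normL1_triangle (H.integrable_control hz.2.1) (H.integrable_control hz'.2.1)
    (H.integrable_control hz''.2.1)
  linarith

/-- The space of processes is complete: a limit control takes its values in the closed sets `V t`,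
and the limit solves the equation by dominated convergence along a subsequence of controls that
converges almost everywhere. -/
theorem processes_complete {z : ℕ → (ℝ → Euc n) × (ℝ → Euc m)}
    (hz : ∀ i, z i ∈ P.Processes xb V R)
    (hcauchy : ∀ ε > 0, ∃ N, ∀ i ≥ N, ∀ j ≥ N, P.procDist (z i) (z j) < ε) :
    ∃ z' ∈ P.Processes xb V R, Tendsto (fun i => P.procDist (z i) z') atTop (𝓝 0) := by
  have hui : ∀ i, Integrable (z i).2 P.leb := fun i => H.integrable_control (hz i).2.1
  -- the limit of the controls
  let W : ℕ → Lp (Euc m) 1 P.leb := fun i => (hui i).toL1 (z i).2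
  have hWdist : ∀ i (v : ℝ → Euc m) (hv : Integrable v P.leb),
      dist (W i) (hv.toL1 v) = P.normL1 (fun t => (z i).2 t - v t) := by
    intro i v hv
    rw [dist_eq_norm, ← Integrable.toL1_sub, L1.norm_of_fun_eq_integral_norm, normL1_eq]
    rfl
  have hWc : CauchySeq W := by
    refine Metric.cauchySeq_iff.2 fun ε hε => ?_
    obtain ⟨N, hN⟩ := hcauchy ε hε
    refine ⟨N, fun i hi j hj => ?_⟩
    rw [hWdist i _ (hui j)]
    exact (P.normL1_le_procDist _ _).trans_lt (hN i hi j hj)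
  obtain ⟨w, hw⟩ := cauchySeq_tendsto_of_complete hWc
  have hwi : Integrable w P.leb := L1.integrable_coeFn w
  have hulim : Tendsto (fun i => P.normL1 (fun t => (z i).2 t - w t)) atTop (𝓝 0) := by
    have h1 := tendsto_iff_dist_tendsto_zero.1 hw
    refine h1.congr fun i => ?_
    rw [← hWdist i w hwi, Integrable.toL1_coeFn]
  obtain ⟨φ, hφ, hφae⟩ := (tendstoInMeasure_of_tendsto_Lp hw).exists_seq_tendsto_ae
  have huae : ∀ᵐ t ∂P.leb, Tendsto (fun i => (z (φ i)).2 t) atTop (𝓝 (w t)) := by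
    filter_upwards [hφae, ae_all_iff.2 fun i => (hui i).coeFn_toL1] with t h1 h2
    exact h1.congr fun i => h2 (φ i)
  have hwV : ∀ᵐ t ∂P.leb, w t ∈ V t := by
    filter_upwards [huae, H.closed, ae_all_iff.2 fun i => (hz i).2.1.2] with t h1 h2 h3
    exact h2.1.mem_of_tendsto h1 (Eventually.of_forall fun i => h3 (φ i))
  -- the uniform limit of the trajectories
  have hxc : ∀ ε > 0, ∃ N, ∀ i ≥ N, ∀ j ≥ N, ∀ t ∈ Icc 0 P.T,
      ‖(z i).1 t - (z j).1 t‖ < ε := by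
    intro ε hε
    obtain ⟨N, hN⟩ := hcauchy ε hε
    exact ⟨N, fun i hi j hj t ht => ((P.le_normC ((hz i).1.1.sub (hz j).1.1) ht).trans
      (P.normC_le_procDist _ _)).trans_lt (hN i hi j hj)⟩
  have hlim : ∀ t, ∃ a, t ∈ Icc 0 P.T → Tendsto (fun i => (z i).1 t) atTop (𝓝 a) := by
    intro t
    by_cases ht : t ∈ Icc 0 P.T
    · have : CauchySeq fun i => (z i).1 t := by
        refine Metric.cauchySeq_iff.2 fun ε hε => ?_
        obtain ⟨N, hN⟩ := hxc ε hε
        exact ⟨N, fun i hi j hj => by rw [dist_eq_norm]; exact hN i hi j hj t ht⟩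
      obtain ⟨a, ha⟩ := cauchySeq_tendsto_of_complete this
      exact ⟨a, fun _ => ha⟩
    · exact ⟨0, fun h => absurd h ht⟩
  choose x hx using hlim
  have hxunif : ∀ ε > 0, ∃ N, ∀ i ≥ N, ∀ t ∈ Icc 0 P.T, ‖(z i).1 t - x t‖ ≤ ε := by
    intro ε hε
    obtain ⟨N, hN⟩ := hxc ε hε
    refine ⟨N, fun i hi t ht => ?_⟩
    refine le_of_tendsto ((hx t ht).const_sub ((z i).1 t)).norm ?_
    filter_upwards [eventually_ge_atTop N] with j hj
    exact (hN i hi j hj t ht).le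
  have hxcont : ContinuousOn x (Icc 0 P.T) := by
    have hunif : TendstoUniformlyOn (fun i => (z i).1) x atTop (Icc 0 P.T) := by
      rw [Metric.tendstoUniformlyOn_iff]
      intro ε hε
      obtain ⟨N, hN⟩ := hxunif (ε / 2) (half_pos hε)
      filter_upwards [eventually_ge_atTop N] with i hi t ht
      rw [dist_comm, dist_eq_norm]
      exact (hN i hi t ht).trans_lt (half_lt_self hε)
    exact hunif.continuousOn (Frequently.of_forall fun i => (hz i).1.1)
  have hxT : x ∈ P.Tube xb R := ⟨hxcont, fun t ht =>
    le_of_tendsto ((hx t ht).sub_const (xb t)).norm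
      (Eventually.of_forall fun i => (hz i).1.2 t ht)⟩
  have hxlim : Tendsto (fun i => P.normC (fun t => (z i).1 t - x t)) atTop (𝓝 0) := by
    refine Metric.tendsto_atTop.2 fun ε hε => ?_
    obtain ⟨N, hN⟩ := hxunif (ε / 2) (half_pos hε)
    refine ⟨N, fun i hi => ?_⟩
    rw [Real.dist_eq, sub_zero, abs_of_nonneg (P.normC_nonneg _)]
    exact (P.normC_le fun t ht => hN i hi t ht).trans_lt (half_lt_self hε)
  have hwsel : (w : ℝ → Euc m) ∈ P.Selections V := ⟨hwi.aestronglyMeasurable.aemeasurable, hwV⟩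
  -- passage to the limit in the integral equation
  have hfae : ∀ᵐ t ∂P.leb, Tendsto (fun i => P.f t ((z (φ i)).1 t) ((z (φ i)).2 t)) atTop
      (𝓝 (P.f t (x t) (w t))) := by
    filter_upwards [huae, H.closed, ae_all_iff.2 fun i => (hz i).2.1.2, hwV,
      ae_all_iff.2 fun i => H.lipschitz (hz i).2.1 (hz i).1 hxT,
      P.ae_leb_iff.2 (ae_of_all _ fun t ht => ht)] with t h1 h2 h3 h4 h5 h6
    have hball : x t ∈ Metric.closedBall (xb t) R := by
      simpa [dist_eq_norm] using hxT.2 t h6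
    have h7 : Tendsto (fun i => P.f t (x t) ((z (φ i)).2 t)) atTop (𝓝 (P.f t (x t) (w t))) :=
      ((h2.2 _ hball) _ h4).tendsto.comp (tendsto_nhdsWithin_iff.2
        ⟨h1, Eventually.of_forall fun i => h3 (φ i)⟩)
    have h8 : Tendsto (fun i => P.f t ((z (φ i)).1 t) ((z (φ i)).2 t) -
        P.f t (x t) ((z (φ i)).2 t)) atTop (𝓝 0) := by
      refine squeeze_zero_norm (fun i => h5 (φ i)) ?_
      have h9 := ((tendsto_iff_norm_sub_tendsto_zero.1 (hx t h6)).comp hφ.tendsto_atTop).const_mul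
        (κ t)
      simpa using h9
    simpa using h8.add h7
  have hint : ∀ t ∈ Icc 0 P.T, x t = x 0 + ∫ s in (0 : ℝ)..t, P.f s (x s) (w s) := by
    intro t ht
    refine tendsto_nhds_unique ((hx t ht).comp hφ.tendsto_atTop) ?_
    have h1 : ∀ i, (z (φ i)).1 t = (z (φ i)).1 0 +
        ∫ s in (0 : ℝ)..t, P.f s ((z (φ i)).1 s) ((z (φ i)).2 s) := fun i =>
      SolvesODE.integral_eq (hz (φ i)).2.2 ht
    have h2 : Tendsto (fun i => ∫ s in (0 : ℝ)..t, P.f s ((z (φ i)).1 s) ((z (φ i)).2 s)) atTop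
        (𝓝 (∫ s in (0 : ℝ)..t, P.f s (x s) (w s))) := by
      refine intervalIntegral.tendsto_integral_filter_of_dominated_convergence
        (fun s => κ s * (1 + R)) (Eventually.of_forall fun i => ?_)
        (Eventually.of_forall fun i => ?_)
        (intervalIntegrable_of_leb (H.integrable.mul_const (1 + R)) ht) ?_
      · exact (intervalIntegrable_of_leb
          (H.integrable_velocity (hz (φ i)).2.1 (hz (φ i)).1) ht).def'.aestronglyMeasurable
      · filter_upwards [P.ae_leb_iff.1 (H.norm_velocity_le (hz (φ i)).2.1 (hz (φ i)).1)]
          with s hs hmem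
        rw [uIoc_of_le ht.1] at hmem
        exact hs ⟨hmem.1.le, hmem.2.trans ht.2⟩
      · filter_upwards [P.ae_leb_iff.1 hfae] with s hs hmem
        rw [uIoc_of_le ht.1] at hmem
        exact hs ⟨hmem.1.le, hmem.2.trans ht.2⟩
    refine Tendsto.congr (fun i => (h1 i).symm) ?_
    exact ((hx 0 ⟨le_rfl, P.T_pos.le⟩).comp hφ.tendsto_atTop).add h2
  refine ⟨(x, w), ⟨hxT, hwsel, H.mem_W11_of_integral hwsel hxT hint⟩, ?_⟩
  simpa [procDist] using hxlim.add hulim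

/-- Ekeland's principle in a ball of the space of processes, for a function of the trajectory that
is Lipschitz in the uniform norm. -/
theorem exists_ekeland_process {F : (ℝ → Euc n) → ℝ} {L : ℝ}
    (hF : ∀ x ∈ P.Tube xb R, ∀ y ∈ P.Tube xb R,
      |F x - F y| ≤ L * P.normC (fun t => x t - y t))
    {zc : (ℝ → Euc n) × (ℝ → Euc m)} (hzc : zc ∈ P.Processes xb V R) {η : ℝ}
    (hF0 : ∀ z ∈ P.Processes xb V R, P.procDist z zc ≤ η → 0 ≤ F z.1)
    {c : ℝ} (hc : 0 < c) {z₀ : (ℝ → Euc n) × (ℝ → Euc m)} (hz₀ : z₀ ∈ P.Processes xb V R)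
    (hz₀η : P.procDist z₀ zc ≤ η) :
    ∃ z ∈ P.Processes xb V R, P.procDist z zc ≤ η ∧ F z.1 + c * P.procDist z z₀ ≤ F z₀.1 ∧
      ∀ z' ∈ P.Processes xb V R, P.procDist z' zc ≤ η →
        F z.1 ≤ F z'.1 + c * P.procDist z' z := by
  set A : Set ((ℝ → Euc n) × (ℝ → Euc m)) :=
    {z | z ∈ P.Processes xb V R ∧ P.procDist z zc ≤ η}
  have hcomplete : ∀ s : ℕ → (ℝ → Euc n) × (ℝ → Euc m), (∀ i, s i ∈ A) →
      (∀ ε > 0, ∃ N, ∀ i ≥ N, ∀ j ≥ N, P.procDist (s i) (s j) < ε) →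
      ∃ p ∈ A, Tendsto (fun i => P.procDist (s i) p) atTop (𝓝 0) := by
    intro s hs hcau
    obtain ⟨p, hp, hlim⟩ := H.processes_complete (fun i => (hs i).1) hcau
    refine ⟨p, ⟨hp, ?_⟩, hlim⟩
    have h1 := hlim.add_const η
    rw [zero_add] at h1
    refine ge_of_tendsto' h1 fun i => ?_
    have h2 := H.procDist_triangle hp (hs i).1 hzc
    rw [P.procDist_comm p (s i)] at h2
    linarith [(hs i).2]
  have hcont : ∀ s : ℕ → (ℝ → Euc n) × (ℝ → Euc m), (∀ i, s i ∈ A) → ∀ p ∈ A,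
      Tendsto (fun i => P.procDist (s i) p) atTop (𝓝 0) →
      Tendsto (fun i => F (s i).1) atTop (𝓝 (F p.1)) := by
    intro s hs p hp hlim
    refine tendsto_iff_norm_sub_tendsto_zero.2 ?_
    have h1 : Tendsto (fun i => |L| * P.procDist (s i) p) atTop (𝓝 0) := by
      simpa using hlim.const_mul |L|
    refine squeeze_zero (fun _ => norm_nonneg _) (fun i => ?_) h1
    refine (hF _ (hs i).1.1 _ hp.1.1).trans ?_
    exact mul_le_mul (le_abs_self L) (P.normC_le_procDist _ _) (P.normC_nonneg _) (abs_nonneg _)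
  obtain ⟨z, hz, h1, h2⟩ := exists_ekeland_point
    (A := A) (D := P.procDist)
    (F := fun z => F z.1) (fun p _ => P.procDist_self p) P.procDist_comm
    (fun p hp q hq o ho => H.procDist_triangle hp.1 hq.1 ho.1) hcomplete
    (fun p hp => hF0 p hp.1 hp.2) hcont hc ⟨hz₀, hz₀η⟩
  exact ⟨z, hz.1, hz.2, h1, fun z' hz' hη => h2 z' ⟨hz', hη⟩⟩

end TubeRegular

end OCProblem

/-! ### From minima over processes to local minima of the penalized functional -/

/-- Switching from `a` to `b i` on the set `A i`, for disjoint sets `A i`, commutes with every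
mapping `G`. -/
theorem switch_apply {k : ℕ} {A : Fin k → Set ℝ} (hA : Pairwise fun i j => Disjoint (A i) (A j))
    {E F : Type*} [AddCommGroup E] [Module ℝ E] [AddCommGroup F] [Module ℝ F] (G : E → F)
    (a : E) (b : Fin k → E) (t : ℝ) :
    G (a + ∑ i, (A i).indicator (1 : ℝ → ℝ) t • (b i - a)) =
      G a + ∑ i, (A i).indicator (1 : ℝ → ℝ) t • (G (b i) - G a) := by
  by_cases h : ∃ i, t ∈ A i
  · obtain ⟨i, hi⟩ := h
    have h0 : ∀ j, j ≠ i → (A j).indicator (1 : ℝ → ℝ) t = 0 := fun j hj =>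
      indicator_of_notMem (fun hj' => disjoint_left.1 (hA hj) hj' hi) _
    rw [Finset.sum_eq_single i (fun j _ hj => by rw [h0 j hj, zero_smul]) (by simp),
      Finset.sum_eq_single i (fun j _ hj => by rw [h0 j hj, zero_smul]) (by simp)]
    simp [indicator_of_mem hi]
  · push Not at h
    simp [indicator_of_notMem (h _)]

theorem switch_mem {k : ℕ} {A : Fin k → Set ℝ} (hA : Pairwise fun i j => Disjoint (A i) (A j))
    {E : Type*} [AddCommGroup E] [Module ℝ E] {a : E} {b : Fin k → E} {V : Set E} (ha : a ∈ V)
    (hb : ∀ i, b i ∈ V) (t : ℝ) : a + ∑ i, (A i).indicator (1 : ℝ → ℝ) t • (b i - a) ∈ V := by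
  by_cases h : ∃ i, t ∈ A i
  · obtain ⟨i, hi⟩ := h
    have h0 : ∀ j, j ≠ i → (A j).indicator (1 : ℝ → ℝ) t = 0 := fun j hj =>
      indicator_of_notMem (fun hj' => disjoint_left.1 (hA hj) hj' hi) _
    rw [Finset.sum_eq_single i (fun j _ hj => by rw [h0 j hj, zero_smul]) (by simp)]
    simpa [indicator_of_mem hi] using hb i
  · push Not at h
    simpa [indicator_of_notMem (h _)] using ha

namespace OCProblem

variable {n m r : ℕ} {P : OCProblem n m r} {xb : ℝ → Euc n} {V : ℝ → Set (Euc m)} {R : ℝ}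
  {κ : ℝ → ℝ}

theorem normC_le_distW11 {x y : ℝ → Euc n} (hx : x ∈ P.W11) (hy : y ∈ P.W11) :
    P.normC (fun t => x t - y t) ≤ P.distW11 x y := by
  refine P.normC_le fun t ht => ?_
  have hi := (W11.integrable_deriv hx).sub (W11.integrable_deriv hy)
  have h1 : x t - y t = (x 0 - y 0) + ∫ s in (0 : ℝ)..t, (deriv x s - deriv y s) := by
    rw [intervalIntegral.integral_sub (intervalIntegrable_of_leb (W11.integrable_deriv hx) ht)
      (intervalIntegrable_of_leb (W11.integrable_deriv hy) ht), W11.eq_integral hx ht,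
      W11.eq_integral hy ht]
    abel
  rw [h1, distW11, normL1_eq]
  exact (norm_add_le _ _).trans (add_le_add_right (norm_integral_le_leb hi ht) _)

namespace TubeRegular

variable (H : P.TubeRegular xb V R κ)
include H

/-- Chattering between `u` and the controls `w i` turns an approximate solution `x` of the relaxed
equation with weights `α i` into a process nearby: `J` is the defect of `x` in the relaxed
equation, `I` bounds the `L¹` distance of the chattering control to `v`. -/
theorem exists_process_near_relaxed {k : ℕ} {w : Fin k → ℝ → Euc m}
    (hw : ∀ i, w i ∈ P.Selections V) {u v : ℝ → Euc m} (hu : u ∈ P.Selections V)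
    (hv : v ∈ P.Selections V) {x : ℝ → Euc n} (hxW : x ∈ P.W11) (hx : x ∈ P.Tube xb R)
    {α : Fin k → ℝ} (hα0 : ∀ i, 0 ≤ α i) (hα1 : ∑ i, α i ≤ 1) {J I ε : ℝ} (hε : 0 < ε)
    (hJ : J = ∫ t in (0 : ℝ)..P.T, ‖deriv x t - P.f t (x t) (u t)
      - ∑ i, α i • (P.f t (x t) (w i t) - P.f t (x t) (u t))‖)
    (hI : I = ∫ t in (0 : ℝ)..P.T, (‖u t - v t‖ + ∑ i, α i * ‖w i t - v t‖))
    (hmargin : ∀ t ∈ Icc 0 P.T,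
      ‖x t - xb t‖ + (J + ε) * Real.exp (∫ s, κ s ∂P.leb) ≤ R) :
    ∃ z ∈ P.Processes xb V R,
      P.normC (fun t => z.1 t - x t) ≤ (J + ε) * Real.exp (∫ s, κ s ∂P.leb) ∧
      P.normL1 (fun t => z.2 t - v t) ≤ I + ε := by
  set h : Fin k → ℝ → Euc n := fun i t => P.f t (x t) (w i t) - P.f t (x t) (u t) with hh
  set q : Fin k → ℝ → ℝ := fun i t => ‖w i t - v t‖ - ‖u t - v t‖ with hq
  have hhi : ∀ i, Integrable (h i) P.leb := fun i =>
    (H.integrable_velocity (hw i) hx).sub (H.integrable_velocity hu hx)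
  have huv : Integrable (fun t => ‖u t - v t‖) P.leb :=
    ((H.integrable_control hu).sub (H.integrable_control hv)).norm
  have hwv : ∀ i, Integrable (fun t => ‖w i t - v t‖) P.leb := fun i =>
    ((H.integrable_control (hw i)).sub (H.integrable_control hv)).norm
  have hqi : ∀ i, Integrable (q i) P.leb := fun i => (hwv i).sub huv
  have hε' : 0 < ε / (k + 1) := by positivity
  obtain ⟨A, hAm, hAd, hA⟩ := exists_chattering hα0 hα1 hhi hqi hε'
  have hkε : ∑ _i : Fin k, ε / (k + 1) ≤ ε := by
    rw [Finset.sum_const, Finset.card_univ, Fintype.card_fin, nsmul_eq_mul, mul_div_assoc',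
      div_le_iff₀ (by positivity)]
    nlinarith
  set ind : Fin k → ℝ → ℝ := fun i => (A i).indicator 1 with hind
  have hindm : ∀ i, Measurable (ind i) := fun i => measurable_one.indicator (hAm i)
  have hindα : ∀ i t, |ind i t - α i| ≤ 1 + |α i| := fun i t => by
    refine (abs_sub _ _).trans (add_le_add_left ?_ _)
    by_cases ht : t ∈ A i <;> simp [hind, ht]
  set u' : ℝ → Euc m := fun t => u t + ∑ i, ind i t • (w i t - u t) with hu'
  have hu'sel : u' ∈ P.Selections V := by
    constructor
    · exact hu.1.add (Finset.aemeasurable_fun_sum _ fun i _ =>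
        (hindm i).aemeasurable.smul ((hw i).1.sub hu.1))
    · filter_upwards [hu.2, ae_all_iff.2 fun i => (hw i).2] with t h1 h2
      exact switch_mem hAd h1 h2 t
  have hcorr : ∀ i, Integrable (fun t => (ind i t - α i) • h i t) P.leb := fun i =>
    (hhi i).bdd_smul (1 + |α i|) ((hindm i).sub_const _).aestronglyMeasurable
      (ae_of_all _ fun t => hindα i t)
  have hcorrq : ∀ i, Integrable (fun t => (ind i t - α i) * q i t) P.leb := fun i =>
    (hqi i).bdd_mul ((hindm i).sub_const _).aestronglyMeasurable (ae_of_all _ fun t => hindα i t)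
  have hres : Integrable (fun t => deriv x t - P.f t (x t) (u t) - ∑ i, α i • h i t) P.leb :=
    ((W11.integrable_deriv hxW).sub (H.integrable_velocity hu hx)).sub
      (integrable_finsetSum _ fun i _ => (hhi i).smul (α i))
  have hJ0 : 0 ≤ J := by
    rw [hJ]; exact intervalIntegral.integral_nonneg P.T_pos.le fun _ _ => norm_nonneg _
  have hdef : ∀ t ∈ Icc 0 P.T,
      ‖x t - (x 0 + ∫ s in (0 : ℝ)..t, P.f s (x s) (u' s))‖ ≤ J + ε := by
    intro t ht
    have h1 : x t - (x 0 + ∫ s in (0 : ℝ)..t, P.f s (x s) (u' s)) =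
        (∫ s in (0 : ℝ)..t, (deriv x s - P.f s (x s) (u s) - ∑ i, α i • h i s)) -
          ∑ i, ∫ s in (0 : ℝ)..t, (ind i s - α i) • h i s := by
      have h2 : ∀ s, deriv x s - P.f s (x s) (u' s) =
          (deriv x s - P.f s (x s) (u s) - ∑ i, α i • h i s) -
            ∑ i, (ind i s - α i) • h i s := by
        intro s
        rw [hu']
        dsimp only
        rw [hind, switch_apply hAd (P.f s (x s))]
        simp only [sub_smul, Finset.sum_sub_distrib, hh]
        abel
      rw [← intervalIntegral.integral_finsetSum fun i _ =>
          intervalIntegrable_of_leb (hcorr i) ht,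
        ← intervalIntegral.integral_sub (intervalIntegrable_of_leb hres ht)
          (intervalIntegrable_of_leb (integrable_finsetSum _ fun i _ => hcorr i) ht)]
      simp_rw [← h2]
      rw [intervalIntegral.integral_sub
          (intervalIntegrable_of_leb (W11.integrable_deriv hxW) ht)
          (intervalIntegrable_of_leb (H.integrable_velocity hu'sel hx) ht),
        W11.eq_integral hxW ht]
      abel
    rw [h1]
    refine (norm_sub_le _ _).trans (add_le_add ?_ ?_)
    · rw [hJ, P.intervalIntegral_eq_leb]
      exact norm_integral_le_leb hres ht
    · exact (norm_sum_le _ _).trans ((Finset.sum_le_sum fun i _ => (hA i t ht).1).trans hkε)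
  obtain ⟨y, hyT, hyS, -, hyx⟩ := H.exists_trajectory_near hu'sel hx (by linarith) hdef hmargin
  refine ⟨(y, u'), ⟨hyT, hu'sel, hyS⟩, P.normC_le hyx, ?_⟩
  have hT : P.T ∈ Icc 0 P.T := ⟨P.T_pos.le, le_rfl⟩
  have h3 : ∀ t, ‖u' t - v t‖ = (‖u t - v t‖ + ∑ i, α i * q i t) +
      ∑ i, (ind i t - α i) * q i t := by
    intro t
    rw [hu']
    dsimp only
    rw [hind, switch_apply hAd (fun a => ‖a - v t‖)]
    simp only [sub_mul, Finset.sum_sub_distrib, hq, smul_eq_mul]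
    ring
  have hαq : Integrable (fun t => ‖u t - v t‖ + ∑ i, α i * q i t) P.leb :=
    huv.add (integrable_finsetSum _ fun i _ => (hqi i).const_mul _)
  have hIi : Integrable (fun t => ‖u t - v t‖ + ∑ i, α i * ‖w i t - v t‖) P.leb :=
    huv.add (integrable_finsetSum _ fun i _ => (hwv i).const_mul _)
  have h4 : P.normL1 (fun t => u' t - v t) =
      (∫ t in (0 : ℝ)..P.T, (‖u t - v t‖ + ∑ i, α i * q i t)) +
        ∑ i, ∫ t in (0 : ℝ)..P.T, (ind i t - α i) * q i t := by
    rw [normL1]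
    simp_rw [h3]
    rw [intervalIntegral.integral_add (intervalIntegrable_of_leb hαq hT)
        (intervalIntegrable_of_leb (integrable_finsetSum _ fun i _ => hcorrq i) hT),
      intervalIntegral.integral_finsetSum fun i _ => intervalIntegrable_of_leb (hcorrq i) hT]
  have h5 : ∫ t in (0 : ℝ)..P.T, (‖u t - v t‖ + ∑ i, α i * q i t) ≤ I := by
    rw [hI]
    refine intervalIntegral.integral_mono_on P.T_pos.le (intervalIntegrable_of_leb hαq hT)
      (intervalIntegrable_of_leb hIi hT) fun t _ => ?_
    refine add_le_add_right (Finset.sum_le_sum fun i _ => ?_) _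
    exact mul_le_mul_of_nonneg_left (sub_le_self _ (norm_nonneg _)) (hα0 i)
  have h6 : ∑ i, ∫ t in (0 : ℝ)..P.T, (ind i t - α i) * q i t ≤ ε :=
    (Finset.sum_le_sum fun i _ => (le_abs_self _).trans (hA i P.T hT).2).trans hkε
  change P.normL1 (fun t => u' t - v t) ≤ I + ε
  rw [h4]
  exact add_le_add h5 h6

end TubeRegular

/-- Exact penalization: a point of minimum over processes of a Lipschitz function of the trajectory
plus a multiple of the distance to the point gives a local minimum on `Z_k` of the functional
penalized by `J_k`. The penalty constant depends on the Lipschitz constant and on `∫ κ` only. -/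
theorem TubeRegular.isLocalMinOnZk {ub : ℝ → Euc m} {δ₀ : ℝ} {k : ℕ} {w : Fin k → ℝ → Euc m}
    (H : P.TubeRegular xb (P.Uk ub δ₀ w) R κ) (hwm : ∀ i, AEMeasurable (w i) P.leb)
    {F : (ℝ → Euc n) → ℝ} {L : ℝ} (hL : 0 ≤ L)
    (hF : ∀ x ∈ P.Tube xb R, ∀ y ∈ P.Tube xb R,
      |F x - F y| ≤ L * P.normC (fun t => x t - y t))
    {y : ℝ → Euc n} {v : ℝ → Euc m} (hyv : (y, v) ∈ P.Processes xb (P.Uk ub δ₀ w) R)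
    (hyR : ∀ t ∈ Icc 0 P.T, ‖y t - xb t‖ ≤ R / 2) {η c : ℝ} (hη : 0 < η) (hc0 : 0 ≤ c)
    (hc1 : c ≤ 1)
    (hmin : ∀ z ∈ P.Processes xb (P.Uk ub δ₀ w) R, P.procDist z (y, v) ≤ η →
      F y ≤ F z.1 + c * P.procDist z (y, v)) :
    P.IsLocalMinOnZk ub δ₀ w
      (fun z => F z.1 + (L + 1) * Real.exp (∫ s, κ s ∂P.leb) * P.Jk w z +
        c * P.perturbation w y v z) (y, v, fun _ => 0) := by
  set E := Real.exp (∫ s, κ s ∂P.leb) with hE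
  have hE0 : 0 < E := Real.exp_pos _
  have hR := H.pos
  have hT := P.T_pos
  have hw : ∀ i, w i ∈ P.Selections (P.Uk ub δ₀ w) := fun i =>
    ⟨hwm i, ae_of_all _ fun t => Or.inr ⟨i, rfl⟩⟩
  obtain ⟨hyT, hv, hyS⟩ := hyv
  have hyW : y ∈ P.W11 := hyS.1
  refine ⟨⟨hyW, hv, by simp, by simp⟩, ?_⟩
  have hJ0 : P.Jk w (y, v, fun _ => 0) = 0 := by
    have : ∀ᵐ t ∂P.leb, ‖deriv y t - P.f t (y t) (v t) -
        ∑ i : Fin k, (0 : ℝ) • (P.f t (y t) (w i t) - P.f t (y t) (v t))‖ = 0 := by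
      filter_upwards [hyS.2] with t ht
      simp [ht]
    unfold Jk
    rw [P.intervalIntegral_eq_leb, integral_congr_ae this, integral_zero]
  have hp0 : P.perturbation w y v (y, v, fun _ => 0) = 0 := by
    simp [perturbation, normC]
  set B := P.T + ∑ i, ∫ t in (0 : ℝ)..P.T, ‖w i t - v t‖ with hB
  have hW0 : ∀ i, 0 ≤ ∫ t in (0 : ℝ)..P.T, ‖w i t - v t‖ := fun i =>
    intervalIntegral.integral_nonneg hT.le fun _ _ => norm_nonneg _
  have hB0 : 0 < B := add_pos_of_pos_of_nonneg hT (Finset.sum_nonneg fun i _ => hW0 i)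
  obtain ⟨ρ, hρ0, hρR, hρη⟩ : ∃ ρ > 0, ρ ≤ R / 8 ∧ ρ * (2 + B) ≤ η / 2 := by
    refine ⟨min (R / 8) (η / 2 / (2 + B)), lt_min (by positivity) (by positivity),
      min_le_left _ _, ?_⟩
    rw [← le_div_iff₀ (by positivity)]
    exact min_le_right _ _
  refine ⟨ρ, hρ0, ?_⟩
  rintro ⟨x, u, α⟩ ⟨hxW, hu, hα0, hα1⟩ hxρ huρ hαρ
  dsimp only at hxW hu hα0 hα1 hxρ huρ hαρ
  have hu : u ∈ P.Selections (P.Uk ub δ₀ w) := hu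
  have hxc := W11.continuousOn hxW
  set d := P.normC (fun t => x t - y t) with hd
  have hdρ : d ≤ ρ := (normC_le_distW11 hxW hyW).trans hxρ.le
  have hd0 : 0 ≤ d := P.normC_nonneg _
  have hxb : ∀ t ∈ Icc 0 P.T, ‖x t - xb t‖ ≤ R / 2 + ρ := fun t ht => by
    have h1 := P.le_normC (hxc.sub hyT.1) ht
    have h2 := norm_sub_le_norm_sub_add_norm_sub (x t) (y t) (xb t)
    linarith [hyR t ht, show ‖x t - y t‖ ≤ d from h1]
  have hxT : x ∈ P.Tube xb R := ⟨hxc, fun t ht => (hxb t ht).trans (by linarith)⟩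
  set J := P.Jk w (x, u, α) with hJ
  have hJnn : 0 ≤ J := intervalIntegral.integral_nonneg hT.le fun _ _ => norm_nonneg _
  set I := ∫ t in (0 : ℝ)..P.T, (‖u t - v t‖ + ∑ i, α i * ‖w i t - v t‖) with hI
  have hInn : 0 ≤ I := intervalIntegral.integral_nonneg hT.le fun t _ =>
    add_nonneg (norm_nonneg _) (Finset.sum_nonneg fun i _ => mul_nonneg (hα0 i) (norm_nonneg _))
  have hpert : P.perturbation w y v (x, u, α) = d + I := rfl
  change F y + (L + 1) * E * P.Jk w (y, v, fun _ => 0) +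
    c * P.perturbation w y v (y, v, fun _ => 0) ≤
    F x + (L + 1) * E * J + c * P.perturbation w y v (x, u, α)
  rw [hJ0, hp0, hpert, mul_zero, mul_zero, add_zero, add_zero]
  have hFxy := hF y hyT x hxT
  rw [P.normC_sub_comm, ← hd] at hFxy
  have hcdI : 0 ≤ c * (d + I) := mul_nonneg hc0 (add_nonneg hd0 hInn)
  -- A large defect is dominated by the penalty alone.
  rcases le_or_gt (L * d) ((L + 1) * E * J) with hbig | hsmall
  · linarith [(abs_le.1 hFxy).2]
  have hEJ : E * J ≤ d := by
    by_contra! hcon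
    have h1 := mul_le_mul_of_nonneg_left hcon.le (by linarith : 0 ≤ L + 1)
    linarith
  have hTmem : P.T ∈ Icc 0 P.T := ⟨hT.le, le_rfl⟩
  have hIρ : I ≤ ρ * B := by
    have huv : ∀ᵐ t ∂P.leb, ‖u t - v t‖ ≤ ρ := by
      rw [eLpNorm_exponent_top] at huρ
      filter_upwards [ae_lt_of_essSup_lt huρ] with t ht
      rw [← ofReal_norm, ENNReal.ofReal_lt_ofReal_iff hρ0] at ht
      exact ht.le
    have huvi : IntervalIntegrable (fun t => ‖u t - v t‖) volume 0 P.T :=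
      intervalIntegrable_of_leb ((H.integrable_control hu).sub (H.integrable_control hv)).norm hTmem
    have hwvi : ∀ i, IntervalIntegrable (fun t => ‖w i t - v t‖) volume 0 P.T := fun i =>
      intervalIntegrable_of_leb
        ((H.integrable_control (hw i)).sub (H.integrable_control hv)).norm hTmem
    have h1 : ∫ t in (0 : ℝ)..P.T, ‖u t - v t‖ ≤ ρ * P.T := by
      rw [P.intervalIntegral_eq_leb]
      have := integral_mono_ae (P.integrable_leb_iff.2 huvi) (integrable_const (μ := P.leb) ρ) huv
      rw [← P.intervalIntegral_eq_leb (fun _ => ρ), intervalIntegral.integral_const, sub_zero,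
        smul_eq_mul, mul_comm] at this
      exact this
    have h2 : I = (∫ t in (0 : ℝ)..P.T, ‖u t - v t‖) +
        ∑ i, α i * ∫ t in (0 : ℝ)..P.T, ‖w i t - v t‖ := by
      have hsum : IntervalIntegrable (fun t => ∑ i, α i * ‖w i t - v t‖) volume 0 P.T :=
        P.integrable_leb_iff.1 (integrable_finsetSum _ fun i _ =>
          P.integrable_leb_iff.2 ((hwvi i).const_mul _))
      rw [hI, intervalIntegral.integral_add huvi hsum,
        intervalIntegral.integral_finsetSum fun i _ => (hwvi i).const_mul _]
      simp_rw [intervalIntegral.integral_const_mul]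
    rw [h2, hB, mul_add, Finset.mul_sum]
    refine add_le_add h1 (Finset.sum_le_sum fun i _ => mul_le_mul_of_nonneg_right ?_ (hW0 i))
    have := hαρ i
    rw [sub_zero] at this
    exact (le_abs_self _).trans this.le
  have hstep : ∀ ε > 0, ε * E ≤ R / 8 → ε * (E + 1) ≤ η / 2 →
      F y ≤ F x + (L + 1) * E * J + c * (d + I) + ε * ((L + 1) * E + 1) := by
    intro ε hε hε1 hε2
    obtain ⟨z, hz, hzx, hzv⟩ := H.exists_process_near_relaxed hw hu hv hxW hxT hα0 hα1 hε
      (J := J) (I := I) rfl rfl (fun t ht => by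
        rw [← hE, add_mul]
        linarith [hxb t ht])
    rw [← hE] at hzx
    have h1 := P.normC_triangle hz.1.1 hxc hyT.1
    have hzd : P.procDist z (y, v) ≤ (J + ε) * E + d + (I + ε) := by
      unfold procDist
      dsimp only
      linarith
    have h2 := hmin z hz (hzd.trans (by
      rw [mul_add] at hρη hε2
      rw [add_mul]
      linarith))
    have h3 := (abs_le.1 (hF z.1 hz.1 x hxT)).2
    have h4 := mul_le_mul_of_nonneg_left hzx hL
    have h5 := mul_le_mul_of_nonneg_left hzd hc0
    have h6 : c * ((J + ε) * E + ε) ≤ 1 * ((J + ε) * E + ε) :=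
      mul_le_mul_of_nonneg_right hc1 (by positivity)
    have h7 : c * ((J + ε) * E + d + (I + ε)) = c * ((J + ε) * E + ε) + c * (d + I) := by ring
    have h8 : (L + 1) * E * J + ε * ((L + 1) * E + 1) = L * ((J + ε) * E) +
        1 * ((J + ε) * E + ε) := by ring
    linarith
  have hlim : Tendsto (fun ε : ℝ => F x + (L + 1) * E * J + c * (d + I) + ε * ((L + 1) * E + 1))
      (𝓝[>] 0) (𝓝 (F x + (L + 1) * E * J + c * (d + I) + 0 * ((L + 1) * E + 1))) :=
    ((continuous_const.add (continuous_id.mul continuous_const)).tendsto 0).mono_left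
      nhdsWithin_le_nhds
  rw [zero_mul, add_zero] at hlim
  refine ge_of_tendsto hlim ?_
  filter_upwards [self_mem_nhdsWithin, Ioc_mem_nhdsGT (show 0 < R / 8 / E by positivity),
    Ioc_mem_nhdsGT (show 0 < η / 2 / (E + 1) by positivity)] with ε hε h1 h2
  exact hstep ε hε ((le_div_iff₀ hE0).1 h1.2) ((le_div_iff₀ (by positivity)).1 h2.2)

end OCProblem

/-! ### The functionals of the trajectory -/

namespace OCProblem

variable {n m r : ℕ} {P : OCProblem n m r} {xb : ℝ → Euc n} {R : ℝ}

theorem abs_sub_ends_le {h : Euc n × Euc n → ℝ} {L : NNReal}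
    (hh : LipschitzOnWith L h (Metric.closedBall (P.ends xb) R)) {x y : ℝ → Euc n}
    (hx : x ∈ P.Tube xb R) (hy : y ∈ P.Tube xb R) :
    |h (P.ends x) - h (P.ends y)| ≤ L * P.normC (fun t => x t - y t) := by
  have h0 : (0 : ℝ) ∈ Icc 0 P.T := ⟨le_rfl, P.T_pos.le⟩
  have hT : P.T ∈ Icc 0 P.T := ⟨P.T_pos.le, le_rfl⟩
  have hmem : ∀ x ∈ P.Tube xb R, P.ends x ∈ Metric.closedBall (P.ends xb) R := fun x hx => by
    rw [Metric.mem_closedBall, dist_eq_norm]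
    exact max_le (hx.2 0 h0) (hx.2 P.T hT)
  have h1 := hh.dist_le_mul _ (hmem x hx) _ (hmem y hy)
  rw [Real.dist_eq, dist_eq_norm] at h1
  refine h1.trans (mul_le_mul_of_nonneg_left ?_ L.2)
  exact max_le (P.le_normC (hx.1.sub hy.1) h0) (P.le_normC (hx.1.sub hy.1) hT)

/-- The state constraint along a continuous curve is bounded above, so that the supremum in `ψ_j`
is a genuine one. -/
theorem bddAbove_stateConstraint {ε₀ : ℝ} (h4 : P.H4 xb ε₀) {x : ℝ → Euc n}
    (hx : ContinuousOn x (Icc 0 P.T)) :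
    BddAbove (range fun t : Icc (0 : ℝ) P.T => P.g t (x t)) := by
  have h1 : UpperSemicontinuousOn (fun t => P.g t (x t)) (Icc 0 P.T) :=
    h4.1.comp (continuousOn_id.prodMk hx) fun t ht => ⟨ht, mem_univ _⟩
  have h2 := h1.bddAbove_of_isCompact isCompact_Icc
  rwa [image_eq_range] at h2

theorem exists_lipschitz_functionals {ε₀ : ℝ} (hε₀ : 0 < ε₀) (h1 : P.H1 xb) (h4 : P.H4 xb ε₀)
    (h5 : P.H5 xb) :
    ∃ R₁ > 0, R₁ ≤ ε₀ ∧ ∃ Lψ ≥ 0, ∃ Lφ ≥ 0, ∀ R ≤ R₁, ∀ x ∈ P.Tube xb R, ∀ y ∈ P.Tube xb R,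
      (∀ j, |P.psi xb j x - P.psi xb j y| ≤ Lψ * P.normC (fun t => x t - y t)) ∧
      |Metric.infDist (P.Φ (P.ends x)) P.S - Metric.infDist (P.Φ (P.ends y)) P.S| ≤
        Lφ * P.normC (fun t => x t - y t) := by
  obtain ⟨L₁, s₁, hs₁, hL₁⟩ := h1
  obtain ⟨L₂, s₂, hs₂, hL₂⟩ := h5.2.1.exists_lipschitzOnWith
  obtain ⟨ρ₀, hρ₀, hg⟩ := h4.2
  obtain ⟨R₂, hR₂, hball⟩ := Metric.nhds_basis_closedBall.mem_iff.1 (inter_mem hs₁ hs₂)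
  have hLφ : LipschitzOnWith L₂ (fun p => Metric.infDist (P.Φ p) P.S) s₂ := by
    rw [← one_mul L₂]
    exact (Metric.lipschitz_infDist_pt P.S).comp_lipschitzOnWith hL₂
  refine ⟨min R₂ ε₀, lt_min hR₂ hε₀, min_le_right _ _, max L₁ ρ₀, le_max_of_le_left L₁.2, L₂, L₂.2,
    fun R hR x hx y hy => ⟨fun j => ?_, ?_⟩⟩
  · have hsub := (Metric.closedBall_subset_closedBall (x := P.ends xb)
      (hR.trans (min_le_left _ _))).trans (hball.trans inter_subset_left)
    have hcost := abs_sub_ends_le (hL₁.mono hsub) hx hy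
    set d := P.normC (fun t => x t - y t) with hd
    have hd0 : 0 ≤ d := P.normC_nonneg _
    have hsup : ∀ x ∈ P.Tube xb R, ∀ y ∈ P.Tube xb R,
        (⨆ t : Icc (0 : ℝ) P.T, P.g t (x t)) ≤
          (⨆ t : Icc (0 : ℝ) P.T, P.g t (y t)) + ρ₀ * P.normC (fun t => x t - y t) := by
      intro x hx y hy
      refine ciSup_le fun t => ?_
      have h1 := hg t t.2 (x t)
        (by simpa [dist_eq_norm] using (hx.2 t t.2).trans (hR.trans (min_le_right _ _))) (y t)
        (by simpa [dist_eq_norm] using (hy.2 t t.2).trans (hR.trans (min_le_right _ _)))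
      have h2 := le_ciSup (bddAbove_stateConstraint h4 hy.1) t
      have h3 : ρ₀ * ‖x t - y t‖ ≤ ρ₀ * P.normC (fun t => x t - y t) :=
        mul_le_mul_of_nonneg_left (P.le_normC (hx.1.sub hy.1) t.2) hρ₀.le
      linarith [(abs_le.1 h1).2]
    have hgd : |(⨆ t : Icc (0 : ℝ) P.T, P.g t (x t)) - ⨆ t : Icc (0 : ℝ) P.T, P.g t (y t)| ≤
        ρ₀ * d := by
      have h1 := hsup x hx y hy
      have h2 := hsup y hy x hx
      rw [P.normC_sub_comm] at h2
      rw [abs_le]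
      constructor <;> linarith
    unfold psi
    refine (abs_max_sub_max_le_max _ _ _ _).trans (max_le ?_ ?_)
    · rw [add_sub_add_right_eq_sub, sub_sub_sub_cancel_right]
      exact hcost.trans (mul_le_mul_of_nonneg_right (le_max_left _ _) hd0)
    · exact hgd.trans (mul_le_mul_of_nonneg_right (le_max_right _ _) hd0)
  · have hsub := (Metric.closedBall_subset_closedBall (x := P.ends xb)
      (hR.trans (min_le_left _ _))).trans (hball.trans inter_subset_right)
    exact abs_sub_ends_le (hLφ.mono hsub) hx hy

theorem psi_center_le {ub : ℝ → Euc m} (hfeas : P.IsFeasible xb ub) (j : ℕ) :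
    P.psi xb j xb ≤ ((j : ℝ) ^ 2)⁻¹ := by
  refine max_le (by simp) ((ciSup_le fun t : Icc (0 : ℝ) P.T => hfeas.2.1 t t.2).trans (by positivity))

/-- Among the processes which satisfy the end-point constraint, `ψ_j` is positive: otherwise the
process would be feasible with a smaller cost than the strong minimum. -/
theorem psi_pos_of_mem {V : ℝ → Set (Euc m)} {κ : ℝ → ℝ} {ε₀ ε : ℝ}
    (h4 : P.H4 xb ε₀) (H : P.TubeRegular xb V R κ) (hRε : R < ε)
    (hmin : ∀ x u, P.IsFeasible x u → (∀ t ∈ Icc (0 : ℝ) P.T, ‖x t - xb t‖ < ε) →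
      P.cost (P.ends xb) ≤ P.cost (P.ends x))
    {z : (ℝ → Euc n) × (ℝ → Euc m)} (hz : z ∈ P.Processes xb V R)
    (hzS : P.Φ (P.ends z.1) ∈ P.S) {j : ℕ} (hj : 1 ≤ j) : 0 < P.psi xb j z.1 := by
  by_contra! hle
  obtain ⟨hcost, hsup⟩ := max_le_iff.1 hle
  have hj0 : (0 : ℝ) < ((j : ℝ) ^ 2)⁻¹ := by
    have : (0 : ℝ) < j := Nat.cast_pos.2 hj
    positivity
  have hfeas : P.IsFeasible z.1 z.2 := by
    refine ⟨⟨H.memLp_control hz.2.1, ?_, hz.2.2⟩, fun t ht => ?_, hzS⟩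
    · filter_upwards [hz.2.1.2, H.subset] with t h1 h2 using h2 h1
    · exact (le_ciSup (bddAbove_stateConstraint h4 hz.1.1) (⟨t, ht⟩ : Icc (0 : ℝ) P.T)).trans hsup
  have := hmin _ _ hfeas fun t ht => (hz.1.2 t ht).trans_lt hRε
  linarith

end OCProblem

/-! ### The alternative for the end-point constraint -/

namespace OCProblem

variable {n m r : ℕ} {P : OCProblem n m r} {xb : ℝ → Euc n} {V : ℝ → Set (Euc m)} {R : ℝ}
  {κ : ℝ → ℝ}

/-- The regular case: if the distance of a process to the processes satisfying `φ = 0` is bounded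
by a multiple of `φ`, then `lam * ψ j + φ` is nonnegative near the reference process for all small
`lam`. There it is at most `lam / j ^ 2` at the reference process, so that Ekeland's principle
moves that process by at most `lam / j`. -/
theorem TubeRegular.exists_minimizers_of_regular (H : P.TubeRegular xb V R κ)
    {φ : (ℝ → Euc n) → ℝ} {ψ : ℕ → (ℝ → Euc n) → ℝ} {Lφ Lψ : ℝ} (hLψ : 0 ≤ Lψ)
    (hφ : ∀ x ∈ P.Tube xb R, ∀ y ∈ P.Tube xb R,
      |φ x - φ y| ≤ Lφ * P.normC (fun t => x t - y t))
    (hψ : ∀ j, ∀ x ∈ P.Tube xb R, ∀ y ∈ P.Tube xb R,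
      |ψ j x - ψ j y| ≤ Lψ * P.normC (fun t => x t - y t))
    (hφ0 : ∀ x, 0 ≤ φ x)
    (hψpos : ∀ j, 1 ≤ j → ∀ z ∈ P.Processes xb V R, φ z.1 = 0 → 0 < ψ j z.1)
    {zc : (ℝ → Euc n) × (ℝ → Euc m)} (hzc : zc ∈ P.Processes xb V R) (hφc : φ zc.1 = 0)
    (hψc : ∀ j, ψ j zc.1 ≤ ((j : ℝ) ^ 2)⁻¹) {c η : ℝ} (hc : 0 < c) (hη : 0 < η)
    (hreg : ∀ z ∈ P.Processes xb V R, P.procDist z zc ≤ η →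
      ∃ z' ∈ P.Processes xb V R, φ z'.1 = 0 ∧ P.procDist z z' ≤ c * φ z.1) :
    ∃ lam > 0, ∀ j : ℕ, 1 ≤ j → ∃ z ∈ P.Processes xb V R,
      P.procDist z zc ≤ R / 2 ∧ P.procDist z zc ≤ (j : ℝ)⁻¹ ∧ ∃ η' > 0,
        ∀ z' ∈ P.Processes xb V R, P.procDist z' z ≤ η' →
          lam * ψ j z.1 + φ z.1 ≤ lam * ψ j z'.1 + φ z'.1 + (j : ℝ)⁻¹ * P.procDist z' z := by
  have hR := H.pos
  obtain ⟨lam, hlam0, hlam1, hlamη, hlamR, hlamc⟩ :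
      ∃ lam > 0, lam ≤ 1 ∧ lam ≤ η / 2 ∧ lam ≤ R / 2 ∧ lam * (Lψ * c) ≤ 1 := by
    refine ⟨min (min 1 (η / 2)) (min (R / 2) (1 / (Lψ * c + 1))), by positivity,
      (min_le_left _ _).trans (min_le_left _ _), (min_le_left _ _).trans (min_le_right _ _),
      (min_le_right _ _).trans (min_le_left _ _), ?_⟩
    have h0 : 0 ≤ Lψ * c := by positivity
    refine (mul_le_mul_of_nonneg_right ((min_le_right _ _).trans (min_le_right _ _)) h0).trans ?_
    rw [one_div_mul_eq_div, div_le_one (by positivity)]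
    linarith
  refine ⟨lam, hlam0, fun j hj => ?_⟩
  have hj1 : (1 : ℝ) ≤ j := Nat.one_le_cast.2 hj
  have hj0 : (0 : ℝ) < j := by linarith
  have hjinv : (j : ℝ)⁻¹ ≤ 1 := inv_le_one_of_one_le₀ hj1
  have hF : ∀ x ∈ P.Tube xb R, ∀ y ∈ P.Tube xb R,
      |(lam * ψ j x + φ x) - (lam * ψ j y + φ y)| ≤
        (lam * Lψ + Lφ) * P.normC (fun t => x t - y t) := by
    intro x hx y hy
    have h1 := abs_add_le (lam * (ψ j x - ψ j y)) (φ x - φ y)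
    rw [abs_mul, abs_of_pos hlam0] at h1
    have h2 := mul_le_mul_of_nonneg_left (hψ j x hx y hy) hlam0.le
    rw [show (lam * ψ j x + φ x) - (lam * ψ j y + φ y) =
      lam * (ψ j x - ψ j y) + (φ x - φ y) by ring]
    linarith [hφ x hx y hy]
  have hF0 : ∀ z ∈ P.Processes xb V R, P.procDist z zc ≤ η → 0 ≤ lam * ψ j z.1 + φ z.1 := by
    intro z hz hzη
    obtain ⟨z', hz', hz'0, hzz'⟩ := hreg z hz hzη
    have h1 := (abs_le.1 (hψ j z.1 hz.1 z'.1 hz'.1)).1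
    have h2 := hψpos j hj z' hz' hz'0
    have h3 := mul_le_mul_of_nonneg_left ((P.normC_le_procDist z z').trans hzz') hLψ
    have h4 : -(Lψ * (c * φ z.1)) ≤ ψ j z.1 := by linarith
    have h5 := mul_le_mul_of_nonneg_left h4 hlam0.le
    have h6 := mul_le_mul_of_nonneg_right hlamc (hφ0 z.1)
    linarith
  obtain ⟨z, hz, hzη, hz1, hz2⟩ := H.exists_ekeland_process hF hzc hF0 (inv_pos.2 hj0) hzc
    (by rw [P.procDist_self]; exact hη.le)
  have hdist : P.procDist z zc ≤ lam * (j : ℝ)⁻¹ := by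
    have h1 := hF0 z hz hzη
    have h2 := mul_le_mul_of_nonneg_left (hψc j) hlam0.le
    have h3 : (j : ℝ)⁻¹ * P.procDist z zc ≤ (j : ℝ)⁻¹ * (lam * (j : ℝ)⁻¹) := by
      have : (j : ℝ)⁻¹ * (lam * (j : ℝ)⁻¹) = lam * ((j : ℝ) ^ 2)⁻¹ := by
        rw [← inv_pow]; ring
      rw [hφc] at hz1
      linarith
    exact le_of_mul_le_mul_left h3 (inv_pos.2 hj0)
  have hdlam : P.procDist z zc ≤ lam := hdist.trans (mul_le_of_le_one_right hlam0.le hjinv)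
  refine ⟨z, hz, hdlam.trans hlamR,
    hdist.trans (mul_le_of_le_one_left (inv_pos.2 hj0).le hlam1), η / 2, half_pos hη,
    fun z' hz' hzz' => hz2 z' hz' ?_⟩
  linarith [H.procDist_triangle hz' hz hzc]

/-- The irregular case: there are processes arbitrarily close to the reference process whose
distance to all processes satisfying `φ = 0` exceeds `j * φ`. Ekeland's principle for `φ` with
coefficient `1 / j` moves such a process by at most `j * φ`, so that `φ` does not vanish at the
minimizer it gives. -/
theorem TubeRegular.exists_minimizers_of_irregular (H : P.TubeRegular xb V R κ)
    {φ : (ℝ → Euc n) → ℝ} {Lφ : ℝ}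
    (hφ : ∀ x ∈ P.Tube xb R, ∀ y ∈ P.Tube xb R,
      |φ x - φ y| ≤ Lφ * P.normC (fun t => x t - y t))
    (hφ0 : ∀ x, 0 ≤ φ x)
    {zc : (ℝ → Euc n) × (ℝ → Euc m)} (hzc : zc ∈ P.Processes xb V R) (hφc : φ zc.1 = 0)
    (hirreg : ∀ c > 0, ∀ η > 0, ∃ z ∈ P.Processes xb V R, P.procDist z zc ≤ η ∧
      ∀ z' ∈ P.Processes xb V R, φ z'.1 = 0 → c * φ z.1 < P.procDist z z')
    {j : ℕ} (hj : 1 ≤ j) :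
    ∃ z ∈ P.Processes xb V R,
      P.procDist z zc ≤ R / 2 ∧ P.procDist z zc ≤ (j : ℝ)⁻¹ ∧ φ z.1 ≠ 0 ∧ ∃ η' > 0,
        ∀ z' ∈ P.Processes xb V R, P.procDist z' z ≤ η' →
          φ z.1 ≤ φ z'.1 + (j : ℝ)⁻¹ * P.procDist z' z := by
  have hR := H.pos
  have hj0 : (0 : ℝ) < j := Nat.cast_pos.2 hj
  obtain ⟨z₀, hz₀, hz₀η, hz₀far⟩ := hirreg j hj0 (min (R / 4) ((j : ℝ)⁻¹ / 2)) (by positivity)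
  have hη₁ := hz₀η.trans (min_le_left _ _)
  have hη₂ := hz₀η.trans (min_le_right _ _)
  have hrad : 0 ≤ j * φ z₀.1 := mul_nonneg hj0.le (hφ0 _)
  obtain ⟨z, hz, -, hz1, hz2⟩ := H.exists_ekeland_process hφ hz₀ (η := j * φ z₀.1 + 1)
    (fun z _ _ => hφ0 z.1) (inv_pos.2 hj0) hz₀ (by rw [P.procDist_self]; linarith)
  have hdist : P.procDist z z₀ ≤ j * φ z₀.1 := by
    rw [← inv_mul_le_iff₀ hj0]
    linarith [hφ0 z.1]
  have hfar := hz₀far zc hzc hφc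
  have htri := H.procDist_triangle hz hz₀ hzc
  refine ⟨z, hz, by linarith, by linarith, fun h0 => ?_, 1, one_pos, fun z' hz' hzz' => ?_⟩
  · have := hz₀far z hz h0
    rw [P.procDist_comm] at this
    linarith
  · exact hz2 z' hz' (by linarith [H.procDist_triangle hz' hz hz₀])

end OCProblem

end

theorem theorem3p2 {n m r : ℕ} (P : OCProblem n m r)
    (xb : ℝ → Euc n) (ub : ℝ → Euc m) (ε₀ δ₀ : ℝ) (hε₀ : 0 < ε₀) (hδ₀ : 0 ≤ δ₀)
    (h1 : P.H1 xb) (h2 : P.H2 xb ub ε₀ δ₀) (h3 : P.H3 xb ε₀) (h4 : P.H4 xb ε₀) (h5 : P.H5 xb)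
    (hU : P.U0ClosedContinuous xb ub ε₀ δ₀)
    (hmin : P.IsStrongLocalMin xb ub)
    (k : ℕ) (w : Fin k → ℝ → Euc m) (hw : ∀ i, w i ∈ P.goodControls xb) :
    ∃ lam : ℝ, 0 ≤ lam ∧ ∃ K : ℝ, 0 < K ∧
      ∃ (y : ℕ → ℝ → Euc n) (v : ℕ → ℝ → Euc m),
        (∀ j : ℕ, 1 ≤ j → (y j, v j) ∈ P.Xk xb ub ε₀ δ₀ w) ∧
        Tendsto (fun j => P.normC (fun t => y j t - xb t)) atTop (𝓝 0) ∧
        Tendsto (fun j => P.normL1 (fun t => v j t - ub t)) atTop (𝓝 0) ∧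
        (∀ j : ℕ, 1 ≤ j →
          P.IsLocalMinOnZk ub δ₀ w (P.reducedFunctional xb w lam K j (y j) (v j))
            (y j, v j, fun _ => 0)) ∧
        (0 < lam ∨ (lam = 0 ∧ ∀ j : ℕ, 1 ≤ j → P.Φ (P.ends (y j)) ∉ P.S)) := by
  obtain ⟨hfeas, ε, hε, hopt⟩ := hmin
  obtain ⟨R₀, hR₀ε, κ, H₀⟩ := OCProblem.exists_tubeRegular hε₀ h2 h3 hU hfeas hw
  obtain ⟨R₁, hR₁, hR₁ε, Lψ, hLψ, Lφ, hLφ, hLip⟩ :=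
    OCProblem.exists_lipschitz_functionals hε₀ h1 h4 h5
  -- a tube on which all hypotheses are available
  obtain ⟨R, hR0, hRR₀, hRR₁, hRε⟩ : ∃ R > 0, R ≤ R₀ ∧ R ≤ R₁ ∧ R < ε :=
    ⟨min R₀ (min R₁ (ε / 2)), lt_min H₀.pos (lt_min hR₁ (half_pos hε)), min_le_left _ _,
      (min_le_right _ _).trans (min_le_left _ _),
      ((min_le_right _ _).trans (min_le_right _ _)).trans_lt (half_lt_self hε)⟩
  have H := H₀.mono hR0 hRR₀
  set V := P.Uk ub δ₀ w with hV
  set φ : (ℝ → Euc n) → ℝ := fun x => Metric.infDist (P.Φ (P.ends x)) P.S with hφdef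
  have hφ : ∀ x ∈ P.Tube xb R, ∀ y ∈ P.Tube xb R,
      |φ x - φ y| ≤ Lφ * P.normC (fun t => x t - y t) := fun x hx y hy =>
    (hLip R hRR₁ x hx y hy).2
  have hψ : ∀ j, ∀ x ∈ P.Tube xb R, ∀ y ∈ P.Tube xb R,
      |P.psi xb j x - P.psi xb j y| ≤ Lψ * P.normC (fun t => x t - y t) := fun j x hx y hy =>
    (hLip R hRR₁ x hx y hy).1 j
  have hφ0 : ∀ x, 0 ≤ φ x := fun x => Metric.infDist_nonneg
  have hφS : ∀ x, φ x = 0 ↔ P.Φ (P.ends x) ∈ P.S := fun x =>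
    (h5.1.mem_iff_infDist_zero ⟨_, hfeas.2.2⟩).symm
  have hzc : (xb, ub) ∈ P.Processes xb V R := by
    refine ⟨H.center_mem, ⟨hfeas.1.1.aestronglyMeasurable.aemeasurable, ?_⟩, hfeas.1.2.2⟩
    filter_upwards [hfeas.1.2.1] with t ht
    exact Or.inl ⟨Metric.mem_closedBall_self hδ₀, ht⟩
  have hφc : φ xb = 0 := (hφS xb).2 hfeas.2.2
  obtain ⟨lam, hlam, hex⟩ : ∃ lam : ℝ, 0 ≤ lam ∧ ∀ j : ℕ, ∃ z : (ℝ → Euc n) × (ℝ → Euc m),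
      1 ≤ j → z ∈ P.Processes xb V R ∧ P.procDist z (xb, ub) ≤ R / 2 ∧
        P.procDist z (xb, ub) ≤ (j : ℝ)⁻¹ ∧ (0 < lam ∨ (lam = 0 ∧ P.Φ (P.ends z.1) ∉ P.S)) ∧
        ∃ η > 0, ∀ z' ∈ P.Processes xb V R, P.procDist z' z ≤ η →
          lam * P.psi xb j z.1 + φ z.1 ≤
            lam * P.psi xb j z'.1 + φ z'.1 + (j : ℝ)⁻¹ * P.procDist z' z := by
    by_cases hreg : ∃ c > 0, ∃ η > 0, ∀ z ∈ P.Processes xb V R, P.procDist z (xb, ub) ≤ η →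
        ∃ z' ∈ P.Processes xb V R, φ z'.1 = 0 ∧ P.procDist z z' ≤ c * φ z.1
    · obtain ⟨c, hc, η, hη, hreg⟩ := hreg
      obtain ⟨lam, hlam, hex⟩ := H.exists_minimizers_of_regular hLψ hφ hψ hφ0
        (fun j hj z hz h0 => OCProblem.psi_pos_of_mem h4 H hRε hopt hz ((hφS _).1 h0) hj)
        hzc hφc (OCProblem.psi_center_le hfeas) hc hη hreg
      refine ⟨lam, hlam.le, fun j => ?_⟩
      by_cases hj : 1 ≤ j
      · obtain ⟨z, hz, hz1, hz2, hz3⟩ := hex j hj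
        exact ⟨z, fun _ => ⟨hz, hz1, hz2, Or.inl hlam, hz3⟩⟩
      · exact ⟨(xb, ub), fun h => absurd h hj⟩
    · push Not at hreg
      refine ⟨0, le_rfl, fun j => ?_⟩
      by_cases hj : 1 ≤ j
      · obtain ⟨z, hz, hz1, hz2, hz3, η, hη, hz4⟩ :=
          H.exists_minimizers_of_irregular hφ hφ0 hzc hφc hreg hj
        refine ⟨z, fun _ => ⟨hz, hz1, hz2, Or.inr ⟨rfl, fun h => hz3 ((hφS _).2 h)⟩, η, hη, ?_⟩⟩
        simpa using hz4
      · exact ⟨(xb, ub), fun h => absurd h hj⟩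
  choose z hz using hex
  have hnear : ∀ j, 1 ≤ j → ∀ t ∈ Icc 0 P.T, ‖(z j).1 t - xb t‖ ≤ R / 2 := fun j hj t ht =>
    ((P.le_normC ((hz j hj).1.1.1.sub H.continuousOn) ht).trans
      (P.normC_le_procDist (z j) (xb, ub))).trans (hz j hj).2.1
  have hinv : Tendsto (fun j : ℕ => (j : ℝ)⁻¹) atTop (𝓝 0) :=
    tendsto_natCast_atTop_atTop.inv_tendsto_atTop
  have hL0 : 0 ≤ lam * Lψ + Lφ := add_nonneg (mul_nonneg hlam hLψ) hLφ
  refine ⟨lam, hlam, (lam * Lψ + Lφ + 1) * Real.exp (∫ s, κ s ∂P.leb), by positivity,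
    fun j => (z j).1, fun j => (z j).2, fun j hj => ?_, ?_, ?_, fun j hj => ?_, ?_⟩
  · refine ⟨P.normC_le fun t ht => (hnear j hj t ht).trans ?_, (hz j hj).1.2.1, (hz j hj).1.2.2⟩
    linarith
  · refine squeeze_zero' (Eventually.of_forall fun j => P.normC_nonneg _) ?_ hinv
    filter_upwards [eventually_ge_atTop 1] with j hj
    exact (P.normC_le_procDist (z j) (xb, ub)).trans (hz j hj).2.2.1
  · refine squeeze_zero' (Eventually.of_forall fun j => P.normL1_nonneg _) ?_ hinv
    filter_upwards [eventually_ge_atTop 1] with j hj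
    exact (P.normL1_le_procDist (z j) (xb, ub)).trans (hz j hj).2.2.1
  · obtain ⟨hzP, -, -, -, η, hη, hzmin⟩ := hz j hj
    have hj1 : (1 : ℝ) ≤ j := Nat.one_le_cast.2 hj
    have hF : ∀ x ∈ P.Tube xb R, ∀ y ∈ P.Tube xb R,
        |(lam * P.psi xb j x + φ x) - (lam * P.psi xb j y + φ y)| ≤
          (lam * Lψ + Lφ) * P.normC (fun t => x t - y t) := by
      intro x hx y hy
      have h1 := abs_add_le (lam * (P.psi xb j x - P.psi xb j y)) (φ x - φ y)
      rw [abs_mul, abs_of_nonneg hlam] at h1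
      have h2 := mul_le_mul_of_nonneg_left (hψ j x hx y hy) hlam
      rw [show (lam * P.psi xb j x + φ x) - (lam * P.psi xb j y + φ y) =
        lam * (P.psi xb j x - P.psi xb j y) + (φ x - φ y) by ring]
      linarith [hφ x hx y hy]
    exact H.isLocalMinOnZk (fun i => (hw i).1.aestronglyMeasurable.aemeasurable) hL0 hF hzP
      (hnear j hj) hη (inv_nonneg.2 (by linarith)) (inv_le_one_of_one_le₀ hj1) hzmin
  · rcases hlam.eq_or_lt with h0 | hpos
    · refine Or.inr ⟨h0.symm, fun j hj => ?_⟩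
      rcases (hz j hj).2.2.2.1 with h | h
      · exact absurd h (by rw [← h0]; exact lt_irrefl _)
      · exact h.2
    · exact Or.inl hpos
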